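/- Let $G$ be a finite directed multigraph with $n$ vertices whose edges are labelled with characters from $\{0,\dots,\sigma-1\}$, where the number of edges and $\sigma$ are polynomial in $n$ (at most $(n+1)^c$ for a fixed $c$). Let $\pi$ be a Wheeler order of $G$, that is, a total order of the vertices such that vertices of in-degree $0$ precede those of positive in-degree and, for all edges $(u,v)$ and $(u',v')$ labelled $a$ and $a'$, if $a<a'$ then $v<v'$, and if $a=a'$ and $u<u'$ then $v\le v'$. Let $B$ be the corresponding Burrows-Wheeler transform: the sequence of the labels of all edges, sorted by source in $\pi$, the out-edges of each vertex being sorted by destination in $\pi$. Let $r$ be the number of runs (maximal nonempty unary substrings) of $B$. Let $D$ be a decomposition of the edges of $G$ into $\upsilon$ edge-disjoint (nonempty, possibly closed) directed paths whose internal vertices have in- and out-degree exactly $1$. Let the vertices be assigned distinct identifiers from $\{0,\dots,n-1\}$ such that for every edge $(u,v)$ with neither $u$ nor $v$ an endpoint of a path in $D$, the identifier of $v$ is the identifier of $u$ plus $1$. Then, on a word RAM with words of $\Theta(\log n)$ bits, $G$ can be stored in $O(\max(1,r+\upsilon))$ words so that, for every pattern $P\in\{0,\dots,\sigma-1\}^*$,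 one can, in $O(\max(1,|P|)\cdot\max(1,\log\log n))$ time, either report that no vertex is reachable by a directed path labelled $P$, or find the first and last rank of an interval of $\pi$ that consists of exactly the vertices reachable by directed paths labelled $P$ (starting anywhere), together with the identifier of the last vertex in that interval. The query program is the same for all $G$, and the constants (including that in the word length, which may also be any larger) depend only on $c$. The query program needs only a constant number of registers besides the read-only stored structure, and reads $P$ once from left to right. -/

import Mathlib

/-! ## Wheeler graphs -/

/-- A directed multigraph with vertex set `V`, edge set `E`, whose edges are labelled with
characters of the ordered alphabet `{0, …, σ - 1}`. -/
structure LabelledGraph (V : Type*) (E : Type*) (σ : ℕ) where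
  src : E → V
  tgt : E → V
  lab : E → Fin σ

namespace LabelledGraph

variable {V : Type*} {E : Type*} {σ : ℕ}

/-- The in-degree of a vertex. -/
noncomputable def inDeg (G : LabelledGraph V E σ) (v : V) : ℕ := Nat.card {e : E // G.tgt e = v}

/-- The out-degree of a vertex. -/
noncomputable def outDeg (G : LabelledGraph V E σ) (v : V) : ℕ := Nat.card {e : E // G.src e = v}

/-- `G.Walk u P v`: there is a directed path from `u` to `v` whose edge labels, read along the
path, spell `P`. -/
inductive Walk (G : LabelledGraph V E σ) : V → List (Fin σ) → V → Prop
  | nil (u : V) : Walk G u [] u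
  | cons (e : E) (P : List (Fin σ)) (v : V) (h : Walk G (G.tgt e) P v) :
      Walk G (G.src e) (G.lab e :: P) v

/-- `v` is reachable by a directed path labelled `P` (starting anywhere). -/
def Reached (G : LabelledGraph V E σ) (P : List (Fin σ)) (v : V) : Prop := ∃ u, G.Walk u P v

/-- The total order of the `n` vertices in which `v` has rank `rank v` is a Wheeler order. -/
structure IsWheelerOrder {n : ℕ} (G : LabelledGraph V E σ) (rank : V ≃ Fin n) : Prop where
  sources_first : ∀ u v, G.inDeg u = 0 → 0 < G.inDeg v → rank u < rank v
  lab_lt : ∀ e e', G.lab e < G.lab e' → rank (G.tgt e) < rank (G.tgt e')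
  lab_eq : ∀ e e', G.lab e = G.lab e' → rank (G.src e) < rank (G.src e') →
    rank (G.tgt e) ≤ rank (G.tgt e')

/-- `B` is the Burrows-Wheeler transform of `G` for the given order: the sequence of the labels of
all edges, sorted by source, the out-edges of each vertex being sorted by destination. -/
def IsBWT {n : ℕ} (G : LabelledGraph V E σ) (rank : V ≃ Fin n) (B : List (Fin σ)) : Prop :=
  ∃ es : List E, es.Nodup ∧ (∀ e, e ∈ es) ∧
    es.Pairwise (fun e e' => rank (G.src e) < rank (G.src e') ∨
      (G.src e = G.src e' ∧ rank (G.tgt e) ≤ rank (G.tgt e'))) ∧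
    B = es.map G.lab

/-- `D` decomposes `G` into edge-disjoint directed paths (each given by its nonempty list of
edges; it may be closed) whose internal vertices have in- and out-degree exactly 1. -/
structure IsPathDecomposition (G : LabelledGraph V E σ) (D : List (List E)) : Prop where
  nonempty : ∀ p ∈ D, p ≠ []
  path : ∀ p ∈ D, p.IsChain (fun e e' => G.tgt e = G.src e' ∧
    G.inDeg (G.tgt e) = 1 ∧ G.outDeg (G.tgt e) = 1)
  disjoint : D.flatten.Nodup
  cover : ∀ e, e ∈ D.flatten

/-- `v` is the first or the last vertex of some path of `D`. -/
def IsEndpoint (G : LabelledGraph V E σ) (D : List (List E)) (v : V) : Prop :=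
  ∃ p ∈ D, (∃ e ∈ p.head?, G.src e = v) ∨ (∃ e ∈ p.getLast?, G.tgt e = v)

/-- Along every edge neither end of which is an endpoint of a path of `D`, the identifier
increases by exactly 1. -/
def IsIdentifier {n : ℕ} (G : LabelledGraph V E σ) (D : List (List E)) (ident : V ≃ Fin n) :
    Prop :=
  ∀ e, ¬ G.IsEndpoint D (G.src e) → ¬ G.IsEndpoint D (G.tgt e) →
    (ident (G.tgt e) : ℕ) = (ident (G.src e) : ℕ) + 1

end LabelledGraph

/-- The number of runs (maximal nonempty unary substrings) of a sequence. -/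
def runCount {α : Type*} [DecidableEq α] : List α → ℕ
  | [] => 0
  | [_] => 1
  | a :: b :: l => (if a = b then 0 else 1) + runCount (b :: l)

/-! ## The word RAM

A machine with `w`-bit words, finitely many named registers per program, a memory that holds the
stored data structure and cannot be written to, and an input tape that holds the query and is
read from left to right. So a program has no work space beyond its registers. Every elementary
instruction and every test costs one step. -/

namespace WordRAM

/-- Arithmetic, bitwise and shift operations on words. -/
inductive BinOp
  | add | sub | mul | div | mod | and | or | xor | shl | shr

/-- The value of an operation on `w`-bit words, modulo `2 ^ w` (division by `0` gives `0`, and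
`a` modulo `0` is `a`). -/
def BinOp.eval (w : ℕ) (o : BinOp) (a b : ℕ) : ℕ :=
  match o with
  | .add => (a + b) % 2 ^ w
  | .sub => (a + (2 ^ w - b)) % 2 ^ w
  | .mul => (a * b) % 2 ^ w
  | .div => (a / b) % 2 ^ w
  | .mod => (a % b) % 2 ^ w
  | .and => (a &&& b) % 2 ^ w
  | .or => (a ||| b) % 2 ^ w
  | .xor => (a ^^^ b) % 2 ^ w
  | .shl => (a <<< b) % 2 ^ w
  | .shr => (a >>> b) % 2 ^ w

/-- Elementary instructions; `d`, `a`, `b` are names of registers. -/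
inductive Instr
  /-- do nothing -/
  | nop
  /-- `d ← k` -/
  | const (d k : ℕ)
  /-- `d ← a` -/
  | copy (d a : ℕ)
  /-- `d ← a o b` -/
  | op (d : ℕ) (o : BinOp) (a b : ℕ)
  /-- `d ←` the memory word whose address is in `a` -/
  | load (d a : ℕ)
  /-- `d ←` the next symbol of the input, which is consumed -/
  | read (d : ℕ)

/-- Tests: equality and order of two registers, and whether any input is left. -/
inductive Cond
  | eq (a b : ℕ)
  | lt (a b : ℕ)
  | more

/-- Structured programs. -/
inductive Cmd
  | instr (i : Instr)
  | seq (p q : Cmd)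
  | ite (c : Cond) (p q : Cmd)
  | loop (c : Cond) (p : Cmd)

/-- A configuration: contents of the registers, and the input that has not been read. -/
structure State where
  reg : ℕ → ℕ
  input : List ℕ

/-- The initial configuration on a given input: all registers hold `0`. -/
def State.start (input : List ℕ) : State := ⟨fun _ => 0, input⟩

/-- Assign `x` to register `d`. -/
def State.set (s : State) (d x : ℕ) : State := ⟨Function.update s.reg d x, s.input⟩

/-- The effect of one instruction, with `w`-bit words and memory contents `mem` (a word outside
the memory, and a symbol after the end of the input, is read as `0`). -/
def Instr.step (w : ℕ) (mem : List ℕ) (s : State) : Instr → State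
  | .nop => s
  | .const d k => s.set d (k % 2 ^ w)
  | .copy d a => s.set d (s.reg a)
  | .op d o a b => s.set d (o.eval w (s.reg a) (s.reg b))
  | .load d a => s.set d (mem.getD (s.reg a) 0)
  | .read d => ⟨Function.update s.reg d (s.input.headD 0 % 2 ^ w), s.input.tail⟩

/-- The meaning of a test. -/
def Cond.holds (s : State) : Cond → Prop
  | .eq a b => s.reg a = s.reg b
  | .lt a b => s.reg a < s.reg b
  | .more => s.input ≠ []

/-- `Exec w mem p s t s'`: with `w`-bit words and memory contents `mem`, the program `p`, started
in configuration `s`, halts after exactly `t` steps in configuration `s'`. -/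
inductive Exec (w : ℕ) (mem : List ℕ) : Cmd → State → ℕ → State → Prop
  | instr (i : Instr) (s : State) : Exec w mem (.instr i) s 1 (i.step w mem s)
  | seq {p q : Cmd} {s s' s'' : State} {t t' : ℕ} (hp : Exec w mem p s t s')
      (hq : Exec w mem q s' t' s'') : Exec w mem (.seq p q) s (t + t') s''
  | ite_true {c : Cond} {p q : Cmd} {s s' : State} {t : ℕ} (hc : c.holds s)
      (hp : Exec w mem p s t s') : Exec w mem (.ite c p q) s (1 + t) s'
  | ite_false {c : Cond} {p q : Cmd} {s s' : State} {t : ℕ} (hc : ¬ c.holds s)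
      (hq : Exec w mem q s t s') : Exec w mem (.ite c p q) s (1 + t) s'
  | loop_done {c : Cond} {p : Cmd} {s : State} (hc : ¬ c.holds s) :
      Exec w mem (.loop c p) s 1 s
  | loop_step {c : Cond} {p : Cmd} {s s' s'' : State} {t t' : ℕ} (hc : c.holds s)
      (hp : Exec w mem p s t s') (hl : Exec w mem (.loop c p) s' t' s'') :
      Exec w mem (.loop c p) s (1 + t + t') s''

end WordRAM

/-- The registers `0, 1, 2, 3` hold the answer to the query `P`: either register `0` holds `0` and
no vertex is reachable by a path labelled `P`, or register `0` holds `1`, the vertices reachable by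
paths labelled `P` are exactly those whose ranks lie in the nonempty interval from register `1` to
register `2`, and register `3` holds the identifier of the last vertex of this interval. -/
def IsToeholdAnswer {V E : Type*} {σ n : ℕ} (G : LabelledGraph V E σ) (rank ident : V ≃ Fin n)
    (P : List (Fin σ)) (reg : ℕ → ℕ) : Prop :=
  (reg 0 = 0 ∧ ∀ v, ¬ G.Reached P v) ∨
  (reg 0 = 1 ∧ reg 1 ≤ reg 2 ∧ reg 2 < n ∧
    (∀ v, G.Reached P v ↔ reg 1 ≤ (rank v : ℕ) ∧ (rank v : ℕ) ≤ reg 2) ∧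
    ∀ v, (rank v : ℕ) = reg 2 → reg 3 = (ident v : ℕ))

/-! In a Wheeler graph the vertices reached by a pattern form an interval of ranks, and appending a
character `a` maps `[i, j]` to another interval, or to nothing. The new left end is the least target
of an `a`-edge with source at least `i`; the new right end is the greatest target of an `a`-edge
with source at most `j`; and the result is nonempty exactly when the last `a`-edge source up to `j`
is at least `i` (`IsWheeler.exists_edge_iff`). So each end is updated by a function of the character
and of one position only.

These functions are piecewise simple. Call `(a, j)` good if an `a`-edge leaves rank `j` and neither
of its ends is an endpoint of a path. Away from a set of breakpoints, goodness passes from `j` to `j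
+ 1` (`Good.succ`), and after a position that is not good no `a`-edge starts at all
(`src_ne_of_not_good`). On a good stretch consecutive sources have consecutive targets
(`IsPathLike.tgt_succ`), so the ends move along with `j`, and the identifier of the new last vertex
is that of the old one plus 1 (`Good.record`). On any other stretch the values are constant, apart
from the left end at the breakpoint itself (`record_of_not_good`). One record per breakpoint
therefore determines the whole update, identifier included.

A breakpoint is position 0 of an occurring character, or lies at or just after the source of an edge
that touches or neighbours an endpoint, that starts just after a rank without in-edges, or that is
next to a label change. Endpoints account for O(υ) of these. A label change between consecutive
non-endpoint ranks is a run boundary of the BWT, and every occurring character has a run, so the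
total is O(max(1, r + υ)) (`exists_breakpoints`).

The breakpoint `(a, j)` is stored as the number `a * n + j` of `L = O(log n)` bits, and a query
needs two predecessor searches per character. Every `L`-th key is a sample, and the binary trie of
the samples is kept in a two-level perfect hash table. Bisection over the `L + 1` trie levels finds
the bucket between two samples, and bisection over its at most `L` keys finds the predecessor, both
in O(log L) = O(log log n) steps for fixed `c`. Sampling makes the trie linear in the number of
keys, and `PerfectHash.exists_isPerfect` makes the table linear in the trie. -/

/-! ### Rules for running programs -/

namespace WordRAM

/-- `p` halts when started in `s`, with time and final configuration satisfying `Q`. -/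
def Halts (w : ℕ) (mem : List ℕ) (p : Cmd) (Q : ℕ → State → Prop) (s : State) : Prop :=
  ∃ t s', Exec w mem p s t s' ∧ Q t s'

namespace Halts

variable {w : ℕ} {mem : List ℕ} {Q : ℕ → State → Prop} {s : State}

theorem mono {p : Cmd} {Q' : ℕ → State → Prop} (h : Halts w mem p Q s)
    (hQ : ∀ t s', Q t s' → Q' t s') : Halts w mem p Q' s := by
  obtain ⟨t, s', he, hq⟩ := h
  exact ⟨t, s', he, hQ _ _ hq⟩

theorem instr {i : Instr} (h : Q 1 (i.step w mem s)) : Halts w mem (.instr i) Q s :=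
  ⟨_, _, .instr i s, h⟩

/-- The postcondition of `p` is that `q` halts suitably, so straight-line code is verified by
applying rules in program order while the running time adds up in the first argument of `Q`. -/
theorem seq {p q : Cmd}
    (h : Halts w mem p (fun t s' => Halts w mem q (fun t' s'' => Q (t + t') s'') s') s) :
    Halts w mem (.seq p q) Q s := by
  obtain ⟨t, s', hp, t', s'', hq, h⟩ := h
  exact ⟨_, _, .seq hp hq, h⟩

theorem ite {c : Cond} {p q : Cmd}
    (h₁ : c.holds s → Halts w mem p (fun t s' => Q (1 + t) s') s)
    (h₂ : ¬ c.holds s → Halts w mem q (fun t s' => Q (1 + t) s') s) :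
    Halts w mem (.ite c p q) Q s := by
  by_cases hc : c.holds s
  · obtain ⟨t, s', hp, h⟩ := h₁ hc
    exact ⟨_, _, .ite_true hc hp, h⟩
  · obtain ⟨t, s', hp, h⟩ := h₂ hc
    exact ⟨_, _, .ite_false hc hp, h⟩

theorem loop_done {c : Cond} {p : Cmd} (hc : ¬ c.holds s) (h : Q 1 s) :
    Halts w mem (.loop c p) Q s := ⟨_, _, .loop_done hc, h⟩

theorem loop_step {c : Cond} {p : Cmd} (hc : c.holds s)
    (h : Halts w mem p (fun t s' => Halts w mem (.loop c p) (fun t' s'' => Q (1 + t + t') s'') s')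
      s) : Halts w mem (.loop c p) Q s := by
  obtain ⟨t, s', hp, t', s'', hq, h⟩ := h
  exact ⟨_, _, .loop_step hc hp hq, h⟩

theorem const {d k : ℕ} (hk : k < 2 ^ w) (h : Q 1 (s.set d k)) :
    Halts w mem (.instr (.const d k)) Q s := by
  apply instr
  simpa [Instr.step, Nat.mod_eq_of_lt hk] using h

theorem copy {d a : ℕ} (h : Q 1 (s.set d (s.reg a))) : Halts w mem (.instr (.copy d a)) Q s :=
  instr h

theorem add {d a b : ℕ} (hb : s.reg a + s.reg b < 2 ^ w)
    (h : Q 1 (s.set d (s.reg a + s.reg b))) : Halts w mem (.instr (.op d .add a b)) Q s := by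
  apply instr
  simpa [Instr.step, BinOp.eval, Nat.mod_eq_of_lt hb] using h

theorem sub {d a b : ℕ} (hb : s.reg b ≤ s.reg a) (ha : s.reg a < 2 ^ w)
    (h : Q 1 (s.set d (s.reg a - s.reg b))) : Halts w mem (.instr (.op d .sub a b)) Q s := by
  apply instr
  have : (s.reg a + (2 ^ w - s.reg b)) % 2 ^ w = s.reg a - s.reg b := by
    rw [show s.reg a + (2 ^ w - s.reg b) = (s.reg a - s.reg b) + 2 ^ w by omega,
      Nat.add_mod_right, Nat.mod_eq_of_lt (by omega)]
  simpa [Instr.step, BinOp.eval, this] using h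

theorem mul {d a b : ℕ} (hb : s.reg a * s.reg b < 2 ^ w)
    (h : Q 1 (s.set d (s.reg a * s.reg b))) : Halts w mem (.instr (.op d .mul a b)) Q s := by
  apply instr
  simpa [Instr.step, BinOp.eval, Nat.mod_eq_of_lt hb] using h

theorem mod {d a b : ℕ} (ha : s.reg a < 2 ^ w)
    (h : Q 1 (s.set d (s.reg a % s.reg b))) : Halts w mem (.instr (.op d .mod a b)) Q s := by
  apply instr
  simpa [Instr.step, BinOp.eval, Nat.mod_eq_of_lt ((Nat.mod_le _ _).trans_lt ha)] using h

theorem shr {d a b : ℕ} (ha : s.reg a < 2 ^ w)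
    (h : Q 1 (s.set d (s.reg a / 2 ^ s.reg b))) : Halts w mem (.instr (.op d .shr a b)) Q s := by
  apply instr
  rw [← Nat.shiftRight_eq_div_pow] at h
  have : s.reg a >>> s.reg b < 2 ^ w := by
    rw [Nat.shiftRight_eq_div_pow]
    exact (Nat.div_le_self _ _).trans_lt ha
  simpa [Instr.step, BinOp.eval, Nat.mod_eq_of_lt this] using h

end Halts

/-! ### Memory laid out as tables -/

/-- A memory image of `c` tables, the `k`-th one being `get k 0, …, get k (len k - 1)`: first the
addresses of the tables, then the tables themselves. -/
def pack (len : ℕ → ℕ) (get : ℕ → ℕ → ℕ) (c : ℕ) : List ℕ :=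
  (List.range c).map (fun k => c + ∑ l ∈ Finset.range k, len l) ++
    (List.range c).flatMap (fun k => (List.range (len k)).map (get k))

theorem length_flatMap_range (len : ℕ → ℕ) (get : ℕ → ℕ → ℕ) (c : ℕ) :
    ((List.range c).flatMap (fun k => (List.range (len k)).map (get k))).length =
      ∑ l ∈ Finset.range c, len l := by
  induction c with
  | zero => simp
  | succ c ih => simp [List.range_succ, Finset.sum_range_succ, ← ih]

theorem length_pack (len : ℕ → ℕ) (get : ℕ → ℕ → ℕ) (c : ℕ) :
    (pack len get c).length = c + ∑ l ∈ Finset.range c, len l := by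
  simp only [pack, List.length_append, length_flatMap_range]
  simp

theorem getD_flatMap_range (len : ℕ → ℕ) (get : ℕ → ℕ → ℕ) {c k i : ℕ} (hk : k < c)
    (hi : i < len k) :
    ((List.range c).flatMap (fun k => (List.range (len k)).map (get k))).getD
      ((∑ l ∈ Finset.range k, len l) + i) 0 = get k i := by
  induction c with
  | zero => omega
  | succ c ih =>
    rw [List.range_succ, List.flatMap_append]
    rcases Nat.lt_succ_iff_lt_or_eq.mp hk with h | rfl
    · rw [List.getD_append, ih h]
      rw [length_flatMap_range]
      have := Finset.sum_le_sum_of_subset (f := len)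
        (Finset.range_subset_range.2 (Nat.succ_le_of_lt h))
      rw [Finset.sum_range_succ] at this
      omega
    · rw [List.getD_append_right _ _ _ _ (by rw [length_flatMap_range]; omega),
        length_flatMap_range, Nat.add_sub_cancel_left]
      simp [List.getD_eq_getElem?_getD, hi]

theorem getD_pack (len : ℕ → ℕ) (get : ℕ → ℕ → ℕ) {c k : ℕ} (hk : k < c) :
    (pack len get c).getD k 0 = c + ∑ l ∈ Finset.range k, len l := by
  rw [pack, List.getD_append _ _ _ _ (by simpa using hk)]
  simp [List.getD_eq_getElem?_getD, hk]

theorem getD_getD_pack (len : ℕ → ℕ) (get : ℕ → ℕ → ℕ) {c k i : ℕ} (hk : k < c)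
    (hi : i < len k) :
    (pack len get c).getD ((pack len get c).getD k 0 + i) 0 = get k i := by
  rw [getD_pack _ _ hk, pack, List.getD_append_right _ _ _ _ (by simp; omega)]
  rw [← getD_flatMap_range len get hk hi]
  congr 1
  simp
  omega

theorem getD_pack_add_lt (len : ℕ → ℕ) (get : ℕ → ℕ → ℕ) {c k i : ℕ} (hk : k < c)
    (hi : i < len k) :
    (pack len get c).getD k 0 + i < (pack len get c).length := by
  rw [getD_pack _ _ hk, length_pack]
  have := Finset.sum_le_sum_of_subset (f := len)
    (Finset.range_subset_range.2 (Nat.succ_le_of_lt hk))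
  rw [Finset.sum_range_succ] at this
  omega

theorem lt_of_mem_pack {len : ℕ → ℕ} {get : ℕ → ℕ → ℕ} {c N : ℕ}
    (h : ∀ k < c, ∀ i < len k, get k i < N) (hN : (pack len get c).length < N) :
    ∀ x ∈ pack len get c, x < N := by
  intro x hx
  rw [length_pack] at hN
  rcases List.mem_append.1 hx with hx | hx
  · obtain ⟨k, hk, rfl⟩ := List.mem_map.1 hx
    have := Finset.sum_le_sum_of_subset (f := len)
      (Finset.range_subset_range.2 (List.mem_range.1 hk).le)
    omega
  · obtain ⟨k, hk, hx⟩ := List.mem_flatMap.1 hx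
    obtain ⟨i, hi, rfl⟩ := List.mem_map.1 hx
    exact h k (List.mem_range.1 hk) i (List.mem_range.1 hi)

/-- `d ←` the entry of the `k`-th table whose index is in `i`. -/
def fetch (d k i : ℕ) : Cmd :=
  .seq (.instr (.const d k)) (.seq (.instr (.load d d))
    (.seq (.instr (.op d .add d i)) (.instr (.load d d))))

/-- The memory holds `c` tables, accessible by `fetch`. -/
def HasTables (w : ℕ) (mem : List ℕ) (len : ℕ → ℕ) (get : ℕ → ℕ → ℕ) (c : ℕ) : Prop :=
  c ≤ 2 ^ w ∧ ∀ k < c, ∀ i < len k,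
    mem.getD k 0 + i < 2 ^ w ∧ mem.getD (mem.getD k 0 + i) 0 = get k i

theorem hasTables_pack {w : ℕ} {len : ℕ → ℕ} {get : ℕ → ℕ → ℕ} {c : ℕ}
    (h : (pack len get c).length ≤ 2 ^ w) : HasTables w (pack len get c) len get c := by
  refine ⟨?_, fun k hk i hi =>
    ⟨(getD_pack_add_lt len get hk hi).trans_le h, getD_getD_pack len get hk hi⟩⟩
  rw [length_pack] at h
  omega

theorem State.set_set (s : State) (d x y : ℕ) : (s.set d x).set d y = s.set d y := by
  simp [State.set]

theorem Halts.fetch {w : ℕ} {mem : List ℕ} {Q : ℕ → State → Prop} {s : State} {len : ℕ → ℕ}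
    {get : ℕ → ℕ → ℕ} {c d k i : ℕ} (hm : HasTables w mem len get c) (hk : k < c) (hd : d ≠ i)
    (hi : s.reg i < len k) (h : Q 4 (s.set d (get k (s.reg i)))) :
    Halts w mem (WordRAM.fetch d k i) Q s := by
  obtain ⟨h₁, h₂⟩ := hm.2 k hk _ hi
  apply Halts.seq
  apply Halts.const (hk.trans_le hm.1)
  apply Halts.seq
  apply Halts.instr
  apply Halts.seq
  apply Halts.add
  · simpa [Instr.step, State.set, Function.update_of_ne hd.symm] using h₁
  apply Halts.instr
  simp only [Instr.step, State.set, Function.update_self, Function.update_of_ne hd.symm,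
    Function.update_idem, h₂]
  exact h

end WordRAM

/-! ### Two-level perfect hashing -/

namespace PerfectHash

/-- The number of multipliers for which `x` and `y` collide. -/
theorem card_collide_le {p s x y : ℕ} (hp : p.Prime) (hx : x < p) (hy : y < p) (hxy : x ≠ y)
    (hs : 0 < s) :
    ((Finset.Icc 1 (p - 1)).filter (fun a => (a * x % p) % s = (a * y % p) % s)).card ≤
      2 * ((p - 1) / s) := by
  set M : ℕ := (p - 1) / s with hM
  let D : ℕ → ℤ := fun a => ((a * x % p : ℕ) : ℤ) - ((a * y % p : ℕ) : ℤ)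
  have hcard : ((Finset.Icc (-(M : ℤ)) M).erase 0).card = 2 * M := by
    rw [Finset.card_erase_of_mem (by simp), Int.card_Icc]
    omega
  have hpz : (0 : ℤ) < p := by exact_mod_cast hp.pos
  -- A prime `p` that divides `(a - b) * (x - y)` divides one of two factors of absolute value below
  -- `p`. The range of `b` includes 0 so that `D 0 = 0` later excludes `D a = 0`.
  have hD : ∀ a b : ℕ, a ∈ Finset.Icc 1 (p - 1) → b ∈ Finset.Icc 0 (p - 1) → D a = D b →
      a = b := by
    intro a b ha hb h
    simp only [Finset.mem_Icc] at ha hb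
    have h1 : ((a : ℤ) - b) * ((x : ℤ) - y) ≡ 0 [ZMOD p] := by
      have e1 : ∀ c z : ℕ, ((c * z % p : ℕ) : ℤ) ≡ c * z [ZMOD p] := by
        intro c z
        push_cast
        exact Int.mod_modEq _ _
      have := ((e1 a x).sub (e1 a y)).symm.trans ((Int.ModEq.refl _).trans
        ((show D a ≡ D b [ZMOD p] by rw [h]).trans ((e1 b x).sub (e1 b y))))
      have h2 := this.sub_right ((b : ℤ) * x - b * y)
      ring_nf at h2 ⊢
      simpa using h2
    rw [Int.modEq_zero_iff_dvd] at h1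
    rcases (Nat.prime_iff_prime_int.1 hp).dvd_or_dvd h1 with h1 | h1
    · have := Int.eq_zero_of_abs_lt_dvd h1 (by rw [abs_lt]; omega)
      omega
    · have := Int.eq_zero_of_abs_lt_dvd h1 (by rw [abs_lt]; omega)
      omega
  have hDs : ∀ a, (a * x % p) % s = (a * y % p) % s → (s : ℤ) ∣ D a := by
    intro a h
    have : (a * y % p) ≡ (a * x % p) [MOD s] := h.symm
    exact (Nat.modEq_iff_dvd.1 this)
  rw [← hcard]
  -- A collision makes `D a` a nonzero multiple of `s` of absolute value at most `p - 1`, which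
  -- leaves `2 * M` possible quotients.
  apply Finset.card_le_card_of_injOn (fun a => D a / s)
  · intro a ha
    simp only [Finset.coe_filter, Set.mem_ofPred_eq] at ha
    obtain ⟨k, hk⟩ := hDs a ha.2
    have hsz : (0 : ℤ) < s := by exact_mod_cast hs
    have h1 : a * x % p < p := Nat.mod_lt _ hp.pos
    have h2 : a * y % p < p := Nat.mod_lt _ hp.pos
    have hne : D a ≠ 0 := by
      intro h0
      have hD0 : D 0 = 0 := by simp [D]
      have := hD a 0 ha.1 (by simp) (h0.trans hD0.symm)
      have := ha.1
      simp at this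
      omega
    have hlt : |D a| ≤ (p - 1 : ℕ) := by
      rw [abs_le]
      simp only [D]
      omega
    have hk0 : k ≠ 0 := by
      rintro rfl
      simp at hk
      exact hne hk
    have hkM : |k| ≤ M := by
      rw [hM]
      push_cast
      rw [Int.le_ediv_iff_mul_le hsz]
      calc |k| * s = |D a| := by rw [hk, abs_mul, abs_of_pos hsz, mul_comm]
        _ ≤ _ := hlt
    simp only [hk, Int.mul_ediv_cancel_left _ hsz.ne', Finset.coe_erase, Finset.coe_Icc,
      Set.mem_sdiff, Set.mem_Icc, Set.mem_singleton_iff]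
    exact ⟨abs_le.1 hkM, hk0⟩
  · intro a ha b hb h
    simp only [Finset.coe_filter, Set.mem_ofPred_eq] at ha hb
    apply hD a b ha.1
    · have := hb.1
      simp only [Finset.mem_Icc] at this ⊢
      omega
    · have := congrArg (· * (s : ℤ)) h
      simpa [Int.ediv_mul_cancel (hDs a ha.2), Int.ediv_mul_cancel (hDs b hb.2)] using this

/-- Some multiplier leads to few collisions. -/
theorem exists_few_collisions {p s : ℕ} (hp : p.Prime) (hs : 0 < s) (S : Finset ℕ)
    (hS : ∀ x ∈ S, x < p) :
    ∃ a < p, (S.offDiag.filter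
      (fun q => (a * q.1 % p) % s = (a * q.2 % p) % s)).card * s ≤ 2 * S.offDiag.card := by
  -- Averaging: if all `p - 1` multipliers were bad, the total number of collisions would exceed the
  -- bound obtained pair by pair from `card_collide_le`.
  by_contra! hcon
  have hp2 := hp.two_le
  have h1 : (p - 1) * (2 * S.offDiag.card + 1) ≤ ∑ a ∈ Finset.Icc 1 (p - 1),
      (S.offDiag.filter (fun q => (a * q.1 % p) % s = (a * q.2 % p) % s)).card * s := by
    have := Finset.card_nsmul_le_sum (Finset.Icc 1 (p - 1)) (fun a =>
      (S.offDiag.filter (fun q => (a * q.1 % p) % s = (a * q.2 % p) % s)).card * s)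
      (2 * S.offDiag.card + 1) (by
        intro a ha
        simp only [Finset.mem_Icc] at ha
        exact hcon a (by omega))
    simpa using this
  have h2 : ∑ a ∈ Finset.Icc 1 (p - 1),
      (S.offDiag.filter (fun q => (a * q.1 % p) % s = (a * q.2 % p) % s)).card =
      ∑ q ∈ S.offDiag, ((Finset.Icc 1 (p - 1)).filter
        (fun a => (a * q.1 % p) % s = (a * q.2 % p) % s)).card := by
    simp only [Finset.card_filter]
    exact Finset.sum_comm
  have h3 : ∑ q ∈ S.offDiag, ((Finset.Icc 1 (p - 1)).filter
        (fun a => (a * q.1 % p) % s = (a * q.2 % p) % s)).card ≤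
        S.offDiag.card * (2 * ((p - 1) / s)) := by
    have := Finset.sum_le_card_nsmul S.offDiag (fun q => ((Finset.Icc 1 (p - 1)).filter
        (fun a => (a * q.1 % p) % s = (a * q.2 % p) % s)).card) (2 * ((p - 1) / s)) (by
      intro q hq
      simp only [Finset.mem_offDiag] at hq
      exact card_collide_le hp (hS _ hq.1) (hS _ hq.2.1) hq.2.2 hs)
    simpa using this
  rw [← Finset.sum_mul, h2] at h1
  have h4 := Nat.mul_le_mul_right s h3
  have h5 : (p - 1) / s * s ≤ p - 1 := Nat.div_mul_le_self _ _
  have h6 : S.offDiag.card * (2 * ((p - 1) / s)) * s ≤ S.offDiag.card * 2 * (p - 1) := by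
    calc _ = S.offDiag.card * 2 * ((p - 1) / s * s) := by ring
      _ ≤ _ := Nat.mul_le_mul_left _ h5
  have h7 : (p - 1) * (2 * S.offDiag.card + 1) = S.offDiag.card * 2 * (p - 1) + (p - 1) := by ring
  omega

/-- A two-level hash function. -/
structure Hash where
  prime : ℕ
  mult : ℕ
  size : ℕ
  mult₂ : ℕ → ℕ
  size₂ : ℕ → ℕ
  offset : ℕ → ℕ
  total : ℕ

namespace Hash

/-- The first-level bucket. -/
def bucket (h : Hash) (x : ℕ) : ℕ := h.mult * x % h.prime % h.size

/-- The position in the second-level tables. -/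
def pos (h : Hash) (x : ℕ) : ℕ :=
  h.offset (h.bucket x) + h.mult₂ (h.bucket x) * x % h.prime % h.size₂ (h.bucket x)

/-- `h` is a hash function modulo `p`, injective on `S`, of linear size. -/
structure IsPerfect (h : Hash) (p : ℕ) (S : Finset ℕ) : Prop where
  prime_eq : h.prime = p
  mult_lt : h.mult < p
  size_pos : 0 < h.size
  size_le : h.size ≤ S.card + 1
  total_le : h.total ≤ 5 * S.card + 1
  mult₂_lt : ∀ b, h.mult₂ b < p
  size₂_le : ∀ b < h.size, h.size₂ b ≤ h.total
  offset_le : ∀ b < h.size, h.offset b ≤ h.total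
  pos_lt : ∀ x, h.pos x < h.total
  injOn : Set.InjOn h.pos S

end Hash

/-- The scheme of Fredman, Komlós and Szemerédi. With `N + 1` buckets for `N` keys some multiplier
leaves at most `2 * N` ordered colliding pairs. A bucket with `k` ordered pairs gets a table of size
`2 * k + 1`, for which some multiplier causes fewer than one collision, hence none. The sizes add up
to at most `5 * N + 1`. -/
theorem exists_isPerfect {p : ℕ} (hp : p.Prime) (S : Finset ℕ) (hS : ∀ x ∈ S, x < p) :
    ∃ h : Hash, h.IsPerfect p S := by
  classical
  set N := S.card with hN
  obtain ⟨a, hap, ha⟩ := exists_few_collisions hp (Nat.succ_pos N) S hS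
  let bk : ℕ → ℕ := fun x => a * x % p % (N + 1)
  let T : ℕ → Finset ℕ := fun b => S.filter (fun x => bk x = b)
  let sz : ℕ → ℕ := fun b => 2 * (T b).offDiag.card + 1
  have hlev : ∀ b, ∃ a₂ < p, ((T b).offDiag.filter
      (fun q => (a₂ * q.1 % p) % sz b = (a₂ * q.2 % p) % sz b)).card * sz b ≤
        2 * (T b).offDiag.card := fun b =>
    exists_few_collisions hp (Nat.succ_pos _) (T b) (fun x hx => hS x (Finset.mem_filter.1 hx).1)
  choose a₂ ha₂p ha₂ using hlev
  let off : ℕ → ℕ := fun b => ∑ b' ∈ Finset.range b, sz b'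
  let h : Hash := ⟨p, a, N + 1, a₂, sz, off, off (N + 1)⟩
  have hbk : ∀ x, h.bucket x = bk x := fun x => rfl
  have hbk_lt : ∀ x, bk x < N + 1 := fun x => Nat.mod_lt _ (Nat.succ_pos _)
  have hpos : ∀ x, off (bk x) ≤ h.pos x ∧ h.pos x < off (bk x + 1) := by
    intro x
    have : a₂ (bk x) * x % p % sz (bk x) < sz (bk x) := Nat.mod_lt _ (Nat.succ_pos _)
    refine ⟨Nat.le_add_right _ _, ?_⟩
    simp only [off, Finset.sum_range_succ]
    exact Nat.add_lt_add_left this _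
  have hmono : Monotone off := by
    intro b b' hb
    exact Finset.sum_le_sum_of_subset (Finset.range_subset_range.2 hb)
  have hcoll : ∑ b ∈ Finset.range (N + 1), (T b).offDiag.card ≤ 2 * N := by
    have h1 : ∑ b ∈ Finset.range (N + 1), (T b).offDiag.card =
        (S.offDiag.filter (fun q => bk q.1 = bk q.2)).card := by
      rw [Finset.card_eq_sum_card_fiberwise (f := fun q => bk q.1) (t := Finset.range (N + 1))]
      · apply Finset.sum_congr rfl
        intro b _
        congr 1
        ext ⟨x, y⟩
        simp only [T, Finset.mem_offDiag, Finset.mem_filter]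
        constructor
        · rintro ⟨⟨hx, rfl⟩, ⟨hy, hxy⟩, hne⟩
          exact ⟨⟨⟨hx, hy, hne⟩, hxy.symm⟩, rfl⟩
        · rintro ⟨⟨⟨hx, hy, hne⟩, hxy⟩, rfl⟩
          exact ⟨⟨hx, rfl⟩, ⟨hy, hxy.symm⟩, hne⟩
      · intro q _
        simpa using hbk_lt q.1
    rw [h1]
    by_contra! hlt
    have h2 := Nat.mul_le_mul_right (N + 1) hlt
    have h3 : S.offDiag.card ≤ N * N := by
      rw [Finset.offDiag_card]
      exact Nat.sub_le _ _
    have h4 : (2 * N + 1) * (N + 1) ≤ 2 * (N * N) :=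
      h2.trans (ha.trans (Nat.mul_le_mul_left 2 h3))
    nlinarith
  refine ⟨h, ⟨rfl, hap, Nat.succ_pos _, le_rfl, ?_, ha₂p, ?_, ?_, ?_, ?_⟩⟩
  · change ∑ b ∈ Finset.range (N + 1), sz b ≤ _
    simp only [sz, Finset.sum_add_distrib, ← Finset.mul_sum, Finset.sum_const, Finset.card_range,
      smul_eq_mul]
    omega
  · intro b hb
    exact Finset.single_le_sum (f := sz) (fun _ _ => Nat.zero_le _) (Finset.mem_range.2 hb)
  · intro b hb
    exact hmono hb.le
  · intro x
    exact (hpos x).2.trans_le (hmono (hbk_lt x))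
  · intro x hx y hy hxy
    have hb : bk x = bk y := by
      rcases lt_trichotomy (bk x) (bk y) with hlt | heq | hlt
      · have := (hpos x).2.trans_le ((hmono hlt).trans (hpos y).1)
        omega
      · exact heq
      · have := (hpos y).2.trans_le ((hmono hlt).trans (hpos x).1)
        omega
    by_contra hne
    have hmem : (x, y) ∈ (T (bk x)).offDiag.filter
        (fun q => (a₂ (bk x) * q.1 % p) % sz (bk x) = (a₂ (bk x) * q.2 % p) % sz (bk x)) := by
      simp only [Finset.mem_filter, Finset.mem_offDiag, T]
      refine ⟨⟨⟨hx, trivial⟩, ⟨hy, hb.symm⟩, hne⟩, ?_⟩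
      have h1 : off (bk x) + a₂ (bk x) * x % p % sz (bk x) =
        off (bk y) + a₂ (bk y) * y % p % sz (bk y) := hxy
      rw [← hb] at h1
      omega
    have h1 := Finset.card_pos.2 ⟨_, hmem⟩
    have h2 := (Nat.mul_le_mul_right (sz (bk x)) h1).trans (ha₂ (bk x))
    simp only [sz] at h2
    omega

end PerfectHash

/-! ### The successor function of intervals -/

/-- The edges of a labelled graph whose vertices are given by their ranks. -/
structure RankedEdges (E : Type*) where
  src : E → ℕ
  tgt : E → ℕ
  lab : E → ℕ

namespace RankedEdges

open Classical in
/-- One more than the largest source, at most `j`, of an edge labelled `a` (`0` if there is no such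
edge). -/
noncomputable def lastSrc {E : Type*} [Fintype E] (X : RankedEdges E) (a j : ℕ) : ℕ :=
  (Finset.univ.filter (fun e => X.lab e = a ∧ X.src e ≤ j)).sup (fun e => X.src e + 1)

open Classical in
/-- The largest target of an edge labelled `a` with source at most `j`. -/
noncomputable def lastTgt {E : Type*} [Fintype E] (X : RankedEdges E) (a j : ℕ) : ℕ :=
  (Finset.univ.filter (fun e => X.lab e = a ∧ X.src e ≤ j)).sup X.tgt

/-- The smallest target of an edge labelled `a` with source at least `i`. -/
noncomputable def firstTgt {E : Type*} (X : RankedEdges E) (a i : ℕ) : ℕ :=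
  sInf {t | ∃ e, X.lab e = a ∧ i ≤ X.src e ∧ X.tgt e = t}

/-- The order of the ranks `0, …, n - 1` is a Wheeler order. -/
structure IsWheeler {E : Type*} (X : RankedEdges E) (n : ℕ) : Prop where
  src_lt : ∀ e, X.src e < n
  tgt_lt : ∀ e, X.tgt e < n
  lab_lt : ∀ e e', X.lab e < X.lab e' → X.tgt e < X.tgt e'
  lab_eq : ∀ e e', X.lab e = X.lab e' → X.src e < X.src e' → X.tgt e ≤ X.tgt e'
  exists_tgt_eq : ∀ e r, X.tgt e ≤ r → r < n → ∃ e', X.tgt e' = r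

/-- Vertices outside `Ep` that lie on an edge have in- and out-degree `1`, and identifiers increase
by `1` along edges between such vertices. -/
structure IsPathLike {E : Type*} (X : RankedEdges E) (Ep : Finset ℕ) (ident : ℕ → ℕ) : Prop where
  src_unique : ∀ e e', X.src e ∉ Ep → X.src e' = X.src e → e' = e
  tgt_unique : ∀ e e', X.tgt e ∉ Ep → X.tgt e' = X.tgt e → e' = e
  exists_tgt_eq : ∀ e, X.src e ∉ Ep → ∃ e', X.tgt e' = X.src e
  exists_src_eq : ∀ e, X.tgt e ∉ Ep → ∃ e', X.src e' = X.tgt e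
  ident_tgt : ∀ e, X.src e ∉ Ep → X.tgt e ∉ Ep → ident (X.tgt e) = ident (X.src e) + 1

variable {E : Type*} {X : RankedEdges E} {n : ℕ} {Ep : Finset ℕ} {ident : ℕ → ℕ}

section

variable [Fintype E]

theorem le_lastSrc {a j : ℕ} {e : E} (ha : X.lab e = a) (hj : X.src e ≤ j) :
    X.src e + 1 ≤ X.lastSrc a j :=
  Finset.le_sup (f := fun e => X.src e + 1) (by simp [ha, hj])

theorem le_lastTgt {a j : ℕ} {e : E} (ha : X.lab e = a) (hj : X.src e ≤ j) :
    X.tgt e ≤ X.lastTgt a j :=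
  Finset.le_sup (f := X.tgt) (by simp [ha, hj])

theorem lastSrc_le {a j m : ℕ} (h : ∀ e, X.lab e = a → X.src e ≤ j → X.src e + 1 ≤ m) :
    X.lastSrc a j ≤ m :=
  Finset.sup_le (by simpa using h)

theorem lastTgt_le {a j m : ℕ} (h : ∀ e, X.lab e = a → X.src e ≤ j → X.tgt e ≤ m) :
    X.lastTgt a j ≤ m :=
  Finset.sup_le (by simpa using h)

theorem exists_of_lt_lastSrc {a i j : ℕ} (h : i < X.lastSrc a j) :
    ∃ e, X.lab e = a ∧ i ≤ X.src e ∧ X.src e ≤ j := by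
  by_contra! hc
  have : X.lastSrc a j ≤ i := lastSrc_le (fun e ha hj => by
    by_contra! h'
    exact absurd (hc e ha (by omega)) (by omega))
  omega

theorem exists_tgt_eq_lastTgt {a j : ℕ} {e : E} (ha : X.lab e = a) (hj : X.src e ≤ j) :
    ∃ e', X.lab e' = a ∧ X.src e' ≤ j ∧ X.tgt e' = X.lastTgt a j := by
  classical
  obtain ⟨e', he', h⟩ := Finset.exists_mem_eq_sup
    (Finset.univ.filter (fun e => X.lab e = a ∧ X.src e ≤ j)) ⟨e, by simp [ha, hj]⟩ X.tgt
  simp only [Finset.mem_filter, Finset.mem_univ, true_and] at he'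
  refine ⟨e', he'.1, he'.2, h.symm.trans ?_⟩
  unfold lastTgt
  congr 1

end

theorem firstTgt_le {a i : ℕ} {e : E} (ha : X.lab e = a) (hi : i ≤ X.src e) :
    X.firstTgt a i ≤ X.tgt e := Nat.sInf_le ⟨e, ha, hi, rfl⟩

theorem exists_tgt_eq_firstTgt {a i : ℕ} {e : E} (ha : X.lab e = a) (hi : i ≤ X.src e) :
    ∃ e', X.lab e' = a ∧ i ≤ X.src e' ∧ X.tgt e' = X.firstTgt a i :=
  Nat.sInf_mem (s := {t | ∃ e, X.lab e = a ∧ i ≤ X.src e ∧ X.tgt e = t}) ⟨_, e, ha, hi, rfl⟩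

theorem firstTgt_eq_of_forall_src_ne {a i i' : ℕ} (hii : i ≤ i')
    (h : ∀ e, X.lab e = a → i ≤ X.src e → i' ≤ X.src e) :
    X.firstTgt a i' = X.firstTgt a i := by
  unfold firstTgt
  congr 1
  ext t
  constructor
  · rintro ⟨e, h1, h2, h3⟩
    exact ⟨e, h1, hii.trans h2, h3⟩
  · rintro ⟨e, h1, h2, h3⟩
    exact ⟨e, h1, h e h1 h2, h3⟩

/-- The targets of the edges labelled `a` with sources in an interval form an interval. -/
theorem IsWheeler.exists_edge_iff [Fintype E] (hX : X.IsWheeler n) {a i j : ℕ}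
    (h : i < X.lastSrc a j) (r : ℕ) :
    (∃ e, X.lab e = a ∧ (i ≤ X.src e ∧ X.src e ≤ j) ∧ X.tgt e = r) ↔
      X.firstTgt a i ≤ r ∧ r ≤ X.lastTgt a j := by
  obtain ⟨e₀, ha₀, hi₀, hj₀⟩ := exists_of_lt_lastSrc h
  constructor
  · rintro ⟨e, ha, ⟨hi, hj⟩, rfl⟩
    exact ⟨firstTgt_le ha hi, le_lastTgt ha hj⟩
  · rintro ⟨h1, h2⟩
    obtain ⟨e₁, ha₁, hi₁, ht₁⟩ := exists_tgt_eq_firstTgt ha₀ hi₀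
    obtain ⟨e₂, ha₂, hj₂, ht₂⟩ := exists_tgt_eq_lastTgt ha₀ hj₀
    -- Vertices with in-edges occupy a final segment of the ranks, so `r` has an in-edge; its label
    -- is squeezed between those of `e₁` and `e₂`.
    obtain ⟨e, he⟩ := hX.exists_tgt_eq e₁ r (by omega) (by have := hX.tgt_lt e₂; omega)
    have hlab : X.lab e = a := by
      rcases lt_trichotomy (X.lab e) a with h' | h' | h'
      · have := hX.lab_lt e e₁ (by omega); omega
      · exact h'
      · have := hX.lab_lt e₂ e (by omega); omega
    -- If the source of `e` is outside the interval, monotonicity of the targets forces `e₀`, `e₁`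
    -- or `e₂`, with its source inside, to end at `r` as well.
    by_cases hi : i ≤ X.src e
    · by_cases hj : X.src e ≤ j
      · exact ⟨e, hlab, ⟨hi, hj⟩, he⟩
      · have h3 := hX.lab_eq e₀ e (by omega) (by omega)
        have h4 := le_lastTgt ha₀ hj₀
        by_cases hj2 : i ≤ X.src e₂
        · have h5 := hX.lab_eq e₂ e (by omega) (by omega)
          exact ⟨e₂, ha₂, ⟨hj2, hj₂⟩, by omega⟩
        · have h5 := hX.lab_eq e₂ e₀ (by omega) (by omega)
          exact ⟨e₀, ha₀, ⟨hi₀, hj₀⟩, by omega⟩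
    · have h3 := hX.lab_eq e e₀ (by omega) (by omega)
      by_cases hj1 : X.src e₁ ≤ j
      · have h5 := hX.lab_eq e e₁ (by omega) (by omega)
        exact ⟨e₁, ha₁, ⟨hi₁, hj1⟩, by omega⟩
      · have h5 := hX.lab_eq e₀ e₁ (by omega) (by omega)
        exact ⟨e₀, ha₀, ⟨hi₀, hj₀⟩, by omega⟩

theorem not_exists_edge [Fintype E] {a i j : ℕ} (h : ¬ i < X.lastSrc a j) (e : E)
    (ha : X.lab e = a) : ¬ (i ≤ X.src e ∧ X.src e ≤ j) := fun hij => by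
  have := le_lastSrc ha hij.2
  omega

/-! ### Breakpoints, and the behaviour between them -/

variable (X Ep) in
/-- Some edge labelled `a` leads from `j` to some vertex, both outside `Ep`. -/
def Good (a j : ℕ) : Prop := ∃ e, X.lab e = a ∧ X.src e = j ∧ X.src e ∉ Ep ∧ X.tgt e ∉ Ep

variable (X Ep) in
/-- The edges at or next to which the successor function of the intervals may change its
behaviour. -/
def Special (e : E) : Prop :=
  X.src e ∈ Ep ∨ X.tgt e ∈ Ep ∨ X.src e + 1 ∈ Ep ∨ (∃ r, r + 1 = X.src e ∧ r ∈ Ep) ∨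
    (∀ e', X.tgt e' + 1 ≠ X.src e) ∨
    ∃ e', X.src e' ∉ Ep ∧ (X.src e' = X.src e + 1 ∨ X.src e = X.src e' + 1) ∧ X.lab e' ≠ X.lab e

variable (X Ep) in
/-- The breakpoints of the successor function of the intervals. -/
def IsKey (a j : ℕ) : Prop :=
  ∃ e, X.lab e = a ∧ (j = 0 ∨ X.Special Ep e ∧ (j = X.src e ∨ j = X.src e + 1))

/-- Rank `j` has an in-edge, hence so does `j + 1`, which is not an endpoint and so has an out-edge.
A different label, or a target that is an endpoint, would make one of the two edges special and `(a,
j + 1)` a breakpoint. -/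
theorem Good.succ (hX : X.IsWheeler n) (hP : X.IsPathLike Ep ident) {a j : ℕ}
    (hg : X.Good Ep a j) (hj : j + 1 < n) (hk : ¬ X.IsKey Ep a (j + 1)) :
    X.Good Ep a (j + 1) := by
  obtain ⟨e, rfl, rfl, hs, ht⟩ := hg
  have hsp : ¬ X.Special Ep e := fun h => hk ⟨e, rfl, .inr ⟨h, .inr rfl⟩⟩
  simp only [Special, not_or, not_exists, not_and] at hsp
  obtain ⟨e₀, he₀⟩ := hP.exists_tgt_eq e hs
  obtain ⟨e₁, he₁⟩ := hX.exists_tgt_eq e₀ (X.src e + 1) (by omega) hj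
  obtain ⟨e₂, he₂⟩ := hP.exists_src_eq e₁ (by rw [he₁]; exact hsp.2.2.1)
  rw [he₁] at he₂
  have hs₂ : X.src e₂ ∉ Ep := by rw [he₂]; exact hsp.2.2.1
  have hl₂ : X.lab e₂ = X.lab e := by
    by_contra hne
    exact hsp.2.2.2.2.2 e₂ hs₂ (.inl he₂) hne
  refine ⟨e₂, hl₂, he₂, hs₂, fun hcon => hk ⟨e₂, hl₂, .inr ⟨.inr (.inl hcon), .inl he₂.symm⟩⟩⟩

/-- An `a`-edge leaving `j + 1` would not be special, so rank `j` would have an in-edge, lie outside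
`Ep` and have an out-edge labelled `a`. As `(a, j)` is not good, that edge ends in `Ep`; then it is
special and makes `(a, j + 1)` a breakpoint after all. -/
theorem src_ne_of_not_good (hP : X.IsPathLike Ep ident) {a j : ℕ} (hg : ¬ X.Good Ep a j)
    (hk : ¬ X.IsKey Ep a (j + 1)) (e : E) (ha : X.lab e = a) : X.src e ≠ j + 1 := by
  intro hj
  have hsp : ¬ X.Special Ep e := fun h => hk ⟨e, ha, .inr ⟨h, .inl hj.symm⟩⟩
  simp only [Special, not_or, not_exists, not_and, not_forall, not_not] at hsp
  obtain ⟨e', he'⟩ := hsp.2.2.2.2.1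
  have he'j : X.tgt e' = j := by omega
  have hjE : j ∉ Ep := hsp.2.2.2.1 j hj.symm
  obtain ⟨e₂, he₂⟩ := hP.exists_src_eq e' (by rw [he'j]; exact hjE)
  rw [he'j] at he₂
  have hl₂ : X.lab e₂ = X.lab e := hsp.2.2.2.2.2 e₂ (by rwa [he₂]) (.inr (by omega))
  refine hk ⟨e₂, hl₂.trans ha, .inr ⟨.inr (.inl ?_), .inr (by omega)⟩⟩
  by_contra ht
  exact hg ⟨e₂, hl₂.trans ha, he₂, by rwa [he₂], ht⟩

theorem Good.of_le (hX : X.IsWheeler n) (hP : X.IsPathLike Ep ident) {a j₀ j : ℕ}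
    (hg : X.Good Ep a j₀) (hjj : j₀ ≤ j) (hj : j < n)
    (hk : ∀ j', j₀ < j' → j' ≤ j → ¬ X.IsKey Ep a j') : X.Good Ep a j := by
  induction j, hjj using Nat.le_induction with
  | base => exact hg
  | succ j hjj ih =>
    exact (ih (by omega) (fun j' h1 h2 => hk j' h1 (by omega))).succ hX hP hj
      (hk _ (by omega) le_rfl)

theorem not_good_of_le (hP : X.IsPathLike Ep ident) {a j₀ j : ℕ}
    (hg : ¬ X.Good Ep a j₀) (hjj : j₀ ≤ j)
    (hk : ∀ j', j₀ < j' → j' ≤ j → ¬ X.IsKey Ep a j') : ¬ X.Good Ep a j := by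
  induction j, hjj using Nat.le_induction with
  | base => exact hg
  | succ j hjj ih =>
    rintro ⟨e, ha, hs, -, -⟩
    exact src_ne_of_not_good hP (ih fun j' h1 h2 => hk j' h1 (by omega))
      (hk _ (by omega) le_rfl) e ha hs

theorem lt_src_of_not_good (hP : X.IsPathLike Ep ident) {a j₀ j : ℕ}
    (hg : ¬ X.Good Ep a j₀)
    (hk : ∀ j', j₀ < j' → j' ≤ j → ¬ X.IsKey Ep a j') (e : E) (ha : X.lab e = a)
    (h : j₀ < X.src e) : j < X.src e := by
  by_contra! hle
  obtain ⟨i, hi⟩ : ∃ i, X.src e = i + 1 := ⟨X.src e - 1, by omega⟩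
  exact src_ne_of_not_good hP
    (not_good_of_le hP hg (show j₀ ≤ i by omega) fun j' h1 h2 => hk j' h1 (by omega))
    (hk _ (by omega) (by omega)) e ha hi

/-- The targets are distinct because that of `e` has a single in-edge. A rank strictly between them
would have an in-edge with the same label, whose source would have to lie strictly between two
consecutive ranks. -/
theorem IsPathLike.tgt_succ (hX : X.IsWheeler n) (hP : X.IsPathLike Ep ident) {e e' : E}
    (hl : X.lab e' = X.lab e) (hs : X.src e' = X.src e + 1) (hse : X.src e ∉ Ep)
    (hse' : X.src e' ∉ Ep) (ht : X.tgt e ∉ Ep) : X.tgt e' = X.tgt e + 1 := by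
  have hle := hX.lab_eq e e' hl.symm (by omega)
  have hne : X.tgt e ≠ X.tgt e' := fun h => by
    have := hP.tgt_unique e e' ht h.symm
    subst this
    omega
  by_contra hcon
  obtain ⟨f, hf⟩ := hX.exists_tgt_eq e (X.tgt e + 1) (by omega)
    (by have := hX.tgt_lt e'; omega)
  have hfl : X.lab f = X.lab e := by
    rcases lt_trichotomy (X.lab f) (X.lab e) with h | h | h
    · have := hX.lab_lt _ _ h; omega
    · exact h
    · have := hX.lab_lt e' f (by omega); omega
  rcases lt_trichotomy (X.src f) (X.src e) with h | h | h
  · have := hX.lab_eq f e hfl h; omega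
  · have := hP.src_unique e f hse h
    subst this; omega
  · rcases (show X.src e + 1 ≤ X.src f by omega).eq_or_lt with h' | h'
    · have := hP.src_unique e' f hse' (by omega)
      subst this; omega
    · have := hX.lab_eq e' f (by omega) (by omega); omega

section

variable [Fintype E]

/-- The source has a single out-edge, and equally labelled edges with a smaller (larger) source have
no larger (smaller) target. -/
theorem Good.values (hX : X.IsWheeler n) (hP : X.IsPathLike Ep ident) {e : E}
    (hs : X.src e ∉ Ep) :
    X.lastSrc (X.lab e) (X.src e) = X.src e + 1 ∧ X.lastTgt (X.lab e) (X.src e) = X.tgt e ∧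
      X.firstTgt (X.lab e) (X.src e) = X.tgt e := by
  refine ⟨le_antisymm (lastSrc_le fun e' _ h => by omega) (le_lastSrc rfl le_rfl),
    le_antisymm (lastTgt_le fun e' hl h => ?_) (le_lastTgt rfl le_rfl),
    le_antisymm (firstTgt_le rfl le_rfl) ?_⟩
  · rcases h.lt_or_eq with h | h
    · exact hX.lab_eq _ _ hl h
    · rw [hP.src_unique e e' hs h]
  · obtain ⟨e', hl, h, ht⟩ := exists_tgt_eq_firstTgt (X := X) (e := e) rfl le_rfl
    rw [← ht]
    rcases h.lt_or_eq with h | h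
    · exact hX.lab_eq _ _ hl.symm h
    · rw [hP.src_unique e e' hs h.symm]

/-- Behaviour after a breakpoint followed by good vertices. -/
theorem Good.record (hX : X.IsWheeler n) (hP : X.IsPathLike Ep ident) {a j₀ j : ℕ}
    (hg : X.Good Ep a j₀) (hjj : j₀ ≤ j) (hj : j < n)
    (hk : ∀ j', j₀ < j' → j' ≤ j → ¬ X.IsKey Ep a j') :
    X.lastSrc a j = j + 1 ∧ X.lastTgt a j = X.lastTgt a j₀ + (j - j₀) ∧
      X.firstTgt a j = X.firstTgt a j₀ + (j - j₀) ∧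
      ident (X.lastTgt a j) = ident j + 1 := by
  have hg' := hg.of_le hX hP hjj hj hk
  have key : X.lastTgt a j = X.lastTgt a j₀ + (j - j₀) ∧
      X.firstTgt a j = X.firstTgt a j₀ + (j - j₀) := by
    induction j, hjj using Nat.le_induction with
    | base => simp
    | succ j hjj ih =>
      have hk' : ∀ j', j₀ < j' → j' ≤ j → ¬ X.IsKey Ep a j' :=
        fun j' h1 h2 => hk j' h1 (by omega)
      have hgj := hg.of_le hX hP hjj (by omega) hk'
      obtain ⟨h1, h2⟩ := ih (by omega) hk' hgj
      obtain ⟨e, rfl, rfl, hs, ht⟩ := hgj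
      obtain ⟨e', hl', hj', hs', ht'⟩ := hg'
      have v := Good.values hX hP hs
      have v' := Good.values hX hP hs'
      have := hP.tgt_succ hX hl' hj' hs hs' ht
      rw [hl', hj'] at v'
      omega
  refine ⟨?_, key.1, key.2, ?_⟩ <;> obtain ⟨e, rfl, rfl, hs, ht⟩ := hg'
  · exact (Good.values hX hP hs).1
  · rw [(Good.values hX hP hs).2.1, hP.ident_tgt e hs ht]

/-- Behaviour after any other breakpoint. -/
theorem record_of_not_good (hP : X.IsPathLike Ep ident) {a j₀ j : ℕ}
    (hg : ¬ X.Good Ep a j₀) (hjj : j₀ ≤ j)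
    (hk : ∀ j', j₀ < j' → j' ≤ j → ¬ X.IsKey Ep a j') :
    X.lastSrc a j = X.lastSrc a j₀ ∧ X.lastTgt a j = X.lastTgt a j₀ ∧
      (j₀ < j → X.firstTgt a j = X.firstTgt a (j₀ + 1)) := by
  -- No `a`-edge has its source in `(j₀, j]`, so nothing enters the two maxima. The edges leaving
  -- `j₀` itself drop out of the minimum once `j₀ < j`, hence the value at `j₀ + 1`.
  have hlt := lt_src_of_not_good hP hg hk
  have hiff : ∀ e, X.lab e = a ∧ X.src e ≤ j ↔ X.lab e = a ∧ X.src e ≤ j₀ := fun e =>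
    ⟨fun ⟨h1, h2⟩ => ⟨h1, by by_contra h; have := hlt e h1 (by omega); omega⟩,
      fun ⟨h1, h2⟩ => ⟨h1, h2.trans hjj⟩⟩
  refine ⟨?_, ?_, fun h => firstTgt_eq_of_forall_src_ne h fun e ha h' =>
    (hlt e ha h').le⟩
  · simp only [lastSrc, hiff]
  · simp only [lastTgt, hiff]

end

end RankedEdges

/-! ### Counting the breakpoints -/

/-- The pairs of consecutive elements with different labels. -/
def labelChanges {E α : Type*} [DecidableEq α] (lab : E → α) : List E → List (E × E)
  | [] => []
  | [_] => []
  | e :: e' :: l => if lab e = lab e' then labelChanges lab (e' :: l)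
      else (e, e') :: labelChanges lab (e' :: l)

theorem length_labelChanges_le {E α : Type*} [DecidableEq α] (lab : E → α) (l : List E) :
    (labelChanges lab l).length ≤ runCount (l.map lab) := by
  induction l with
  | nil => simp [labelChanges]
  | cons e l ih =>
    cases l with
    | nil => simp [labelChanges]
    | cons e' l =>
      simp only [labelChanges, List.map_cons, runCount] at ih ⊢
      split_ifs with h
      · simpa using ih
      · simp only [List.length_cons]; omega

theorem mem_labelChanges {E α : Type*} [DecidableEq α] (lab : E → α) {e e' : E}
    (h : lab e ≠ lab e') (l₁ l₂ : List E) :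
    (e, e') ∈ labelChanges lab (l₁ ++ e :: e' :: l₂) := by
  induction l₁ with
  | nil => simp [labelChanges, h]
  | cons f l₁ ih =>
    rcases l₁ with _ | ⟨f', l₁⟩
    all_goals
      simp only [List.nil_append, List.cons_append, labelChanges] at ih ⊢
      split_ifs
      all_goals simp_all

/-- Every symbol that occurs has a run of its own. This pays for the breakpoints at position 0, one
per occurring character. -/
theorem card_toFinset_le_runCount {α : Type*} [DecidableEq α] (l : List α) :
    l.toFinset.card ≤ runCount l := by
  induction l with
  | nil => simp
  | cons a l ih =>
    cases l with
    | nil => simp [runCount]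
    | cons b l =>
      simp only [runCount]
      rw [List.toFinset_cons]
      split_ifs with h
      · rw [Finset.insert_eq_of_mem (by simp [h])]
        omega
      · have := Finset.card_insert_le a (b :: l).toFinset
        omega

namespace RankedEdges

variable {E : Type*} [Fintype E] {X : RankedEdges E} {n : ℕ} {Ep : Finset ℕ} {ident : ℕ → ℕ}

/-- A source outside `Ep` has one out-edge, so the sources just before or just after an endpoint
inject into `Ep`, once for each side. Edges that touch endpoints are in `EE`, and each label change
contributes its two edges. -/
theorem exists_special_superset (hX : X.IsWheeler n) (hP : X.IsPathLike Ep ident)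
    (EE : Finset E) (hEE : ∀ e, X.src e ∈ Ep ∨ X.tgt e ∈ Ep → e ∈ EE) (Ch : List (E × E))
    (hCh : ∀ e e', X.src e ∉ Ep → X.src e' ∉ Ep → X.src e' = X.src e + 1 → X.lab e ≠ X.lab e' →
      (e, e') ∈ Ch) :
    ∃ Z : Finset E, (∀ e, X.Special Ep e → e ∈ Z) ∧
      Z.card ≤ EE.card + 2 * Ep.card + 2 * Ch.length + 1 := by
  classical
  let A : Finset E := Finset.univ.filter (fun e => X.src e ∉ Ep ∧ X.src e + 1 ∈ Ep)
  let B : Finset E := Finset.univ.filter (fun e => X.src e ∉ Ep ∧ ∃ r, r + 1 = X.src e ∧ r ∈ Ep)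
  let C : Finset E := Finset.univ.filter (fun e => X.src e ∉ Ep ∧ ∀ e', X.tgt e' + 1 ≠ X.src e)
  have hA : A.card ≤ Ep.card := by
    apply Finset.card_le_card_of_injOn (fun e => X.src e + 1)
    · intro e he
      simp only [A, Finset.coe_filter, Finset.mem_univ, true_and, Set.mem_ofPred_eq] at he
      exact he.2
    · intro e he e' he' h
      simp only [A, Finset.coe_filter, Finset.mem_univ, true_and, Set.mem_ofPred_eq] at he he'
      exact hP.src_unique _ _ he'.1 (by simpa using h)
  have hB : B.card ≤ Ep.card := by
    apply Finset.card_le_card_of_injOn (fun e => X.src e - 1)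
    · intro e he
      simp only [B, Finset.coe_filter, Finset.mem_univ, true_and, Set.mem_ofPred_eq] at he
      obtain ⟨-, r, hr, hr'⟩ := he
      simpa [← hr] using hr'
    · intro e he e' he' h
      simp only [B, Finset.coe_filter, Finset.mem_univ, true_and, Set.mem_ofPred_eq] at he he'
      obtain ⟨-, r, hr, -⟩ := he
      obtain ⟨he', r', hr', -⟩ := he'
      dsimp only at h
      exact hP.src_unique _ _ he' (by omega)
  -- Of two such sources the lower has an in-edge, and then so does the rank just before the higher
  -- one, a contradiction.
  have hC : C.card ≤ 1 := by
    have aux : ∀ e ∈ C, ∀ e' ∈ C, ¬ X.src e < X.src e' := by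
      intro e he e' he' hlt
      simp only [C, Finset.mem_filter, Finset.mem_univ, true_and] at he he'
      obtain ⟨e₀, he₀⟩ := hP.exists_tgt_eq e he.1
      obtain ⟨e₁, he₁⟩ := hX.exists_tgt_eq e₀ (X.src e' - 1) (by omega)
        (by have := hX.src_lt e'; omega)
      exact he'.2 e₁ (by omega)
    rw [Finset.card_le_one]
    intro e he e' he'
    have h1 := aux e he e' he'
    have h2 := aux e' he' e he
    exact hP.src_unique e' e (by simpa [C] using fun h => (Finset.mem_filter.1 he').2.1 h)
      (by omega)
  refine ⟨EE ∪ A ∪ B ∪ C ∪ (Ch.map Prod.fst).toFinset ∪ (Ch.map Prod.snd).toFinset, ?_, ?_⟩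
  · intro e he
    by_cases hs : X.src e ∈ Ep
    · simp [hEE e (.inl hs)]
    rcases he with he | he | he | he | he | ⟨e', hs', he, hne⟩
    · exact absurd he hs
    · simp [hEE e (.inr he)]
    · have : e ∈ A := by simp [A, hs, he]
      simp [this]
    · have : e ∈ B := by simpa [B, hs] using he
      simp [this]
    · have : e ∈ C := by simpa [C, hs] using he
      simp [this]
    · rcases he with he | he
      · have : e ∈ (Ch.map Prod.fst).toFinset :=
          List.mem_toFinset.2 (List.mem_map.2 ⟨_, hCh e e' hs hs' he hne.symm, rfl⟩)
        simp only [Finset.mem_union, this, true_or, or_true]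
      · have : e ∈ (Ch.map Prod.snd).toFinset :=
          List.mem_toFinset.2 (List.mem_map.2 ⟨_, hCh e' e hs' hs he hne, rfl⟩)
        simp only [Finset.mem_union, this, or_true]
  · have h1 := List.toFinset_card_le (Ch.map Prod.fst)
    have h2 := List.toFinset_card_le (Ch.map Prod.snd)
    rw [List.length_map] at h1 h2
    have u1 := Finset.card_union_le (EE ∪ A ∪ B ∪ C ∪ (Ch.map Prod.fst).toFinset)
      (Ch.map Prod.snd).toFinset
    have u2 := Finset.card_union_le (EE ∪ A ∪ B ∪ C) (Ch.map Prod.fst).toFinset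
    have u3 := Finset.card_union_le (EE ∪ A ∪ B) C
    have u4 := Finset.card_union_le (EE ∪ A) B
    have u5 := Finset.card_union_le EE A
    omega

/-- The breakpoints as numbers. -/
theorem exists_keys (hX : X.IsWheeler n) {Z : Finset E} (hZ : ∀ e, X.Special Ep e → e ∈ Z)
    {σ : ℕ} (hσ : ∀ e, X.lab e < σ) :
    ∃ S : Finset ℕ, 0 ∈ S ∧ (∀ x ∈ S, x = 0 ∨ x < σ * n) ∧
      (∀ a j, j < n → X.IsKey Ep a j → a * n + j ∈ S) ∧
      S.card ≤ 1 + 2 * Z.card + (Finset.univ.image X.lab).card := by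
  classical
  -- The key 0 guarantees that every search finds a predecessor. The filter omits the position after
  -- `n - 1`, whose code would be that of position 0 of the next character.
  refine ⟨insert 0 ((Z.image (fun e => X.lab e * n + X.src e)) ∪
    ((Z.filter (fun e => X.src e + 1 < n)).image (fun e => X.lab e * n + (X.src e + 1))) ∪
    (Finset.univ.image X.lab).image (fun a => a * n)), by simp, ?_, ?_, ?_⟩
  · have hlt : ∀ e : E, ∀ j < n, X.lab e * n + j < σ * n := fun e j hj => by
      have := Nat.mul_le_mul_right n (Nat.succ_le_of_lt (hσ e))
      rw [Nat.succ_mul] at this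
      omega
    intro x hx
    simp only [Finset.mem_insert, Finset.mem_union, Finset.mem_image, Finset.mem_filter,
      Finset.mem_univ, true_and] at hx
    rcases hx with rfl | (⟨e, -, rfl⟩ | ⟨e, ⟨-, hj⟩, rfl⟩) | ⟨a, ⟨e, rfl⟩, rfl⟩
    · exact .inl rfl
    · exact .inr (hlt e _ (hX.src_lt e))
    · exact .inr (hlt e _ hj)
    · exact .inr (hlt e 0 (by have := hX.src_lt e; omega))
  · rintro a j hj ⟨e, rfl, rfl | ⟨hs, rfl | rfl⟩⟩
    · simp only [Finset.mem_insert, Finset.mem_union, Finset.mem_image]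
      exact .inr (.inr ⟨_, ⟨e, Finset.mem_univ _, rfl⟩, rfl⟩)
    · simp only [Finset.mem_insert, Finset.mem_union, Finset.mem_image]
      exact .inr (.inl (.inl ⟨e, hZ e hs, rfl⟩))
    · simp only [Finset.mem_insert, Finset.mem_union, Finset.mem_image, Finset.mem_filter]
      exact .inr (.inl (.inr ⟨e, ⟨hZ e hs, hj⟩, rfl⟩))
  · have h1 := Finset.card_image_le (s := Z) (f := fun e => X.lab e * n + X.src e)
    have h2 := Finset.card_image_le (s := Z.filter (fun e => X.src e + 1 < n))
      (f := fun e => X.lab e * n + (X.src e + 1))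
    have h3 := Finset.card_image_le (s := Finset.univ.image X.lab) (f := fun a => a * n)
    have h4 := Finset.card_filter_le Z (fun e => X.src e + 1 < n)
    refine (Finset.card_insert_le _ _).trans ?_
    have h5 := Finset.card_union_le ((Z.image (fun e => X.lab e * n + X.src e)) ∪
      ((Z.filter (fun e => X.src e + 1 < n)).image (fun e => X.lab e * n + (X.src e + 1))))
      ((Finset.univ.image X.lab).image (fun a => a * n))
    have h6 := Finset.card_union_le (Z.image (fun e => X.lab e * n + X.src e))
      ((Z.filter (fun e => X.src e + 1 < n)).image (fun e => X.lab e * n + (X.src e + 1)))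
    omega

end RankedEdges

/-! ### From the graph to its ranked edges -/

namespace LabelledGraph

variable {V E : Type*} {σ n : ℕ}

/-- The edges of a graph, described by the ranks of their ends. -/
def ranked (G : LabelledGraph V E σ) (rank : V ≃ Fin n) : RankedEdges E where
  src e := (rank (G.src e) : ℕ)
  tgt e := (rank (G.tgt e) : ℕ)
  lab e := (G.lab e : ℕ)

/-- The identifier of the vertex of a given rank. -/
def identOfRank (rank ident : V ≃ Fin n) (r : ℕ) : ℕ :=
  if h : r < n then (ident (rank.symm ⟨r, h⟩) : ℕ) else 0

theorem identOfRank_rank (rank ident : V ≃ Fin n) (v : V) :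
    identOfRank rank ident (rank v : ℕ) = (ident v : ℕ) := by
  simp [identOfRank]

theorem identOfRank_le (rank ident : V ≃ Fin n) (r : ℕ) : identOfRank rank ident r ≤ n := by
  unfold identOfRank
  split_ifs
  · exact (ident _).isLt.le
  · exact Nat.zero_le _

variable {G : LabelledGraph V E σ} {rank ident : V ≃ Fin n} {D : List (List E)}

theorem inDeg_pos [Finite E] (e : E) : 0 < G.inDeg (G.tgt e) :=
  haveI : Nonempty {e' : E // G.tgt e' = G.tgt e} := ⟨⟨e, rfl⟩⟩
  Nat.card_pos

theorem eq_of_inDeg_eq_one {v : V} (h : G.inDeg v = 1) {e e' : E} (he : G.tgt e = v)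
    (he' : G.tgt e' = v) : e = e' := by
  have := (Nat.card_eq_one_iff_unique.1 h).1
  exact congrArg Subtype.val (Subsingleton.elim (⟨e, he⟩ : {e : E // G.tgt e = v}) ⟨e', he'⟩)

theorem eq_of_outDeg_eq_one {v : V} (h : G.outDeg v = 1) {e e' : E} (he : G.src e = v)
    (he' : G.src e' = v) : e = e' := by
  have := (Nat.card_eq_one_iff_unique.1 h).1
  exact congrArg Subtype.val (Subsingleton.elim (⟨e, he⟩ : {e : E // G.src e = v}) ⟨e', he'⟩)

theorem IsWheelerOrder.isWheeler_ranked [Finite E] (h : G.IsWheelerOrder rank) :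
    (G.ranked rank).IsWheeler n where
  src_lt e := (rank _).isLt
  tgt_lt e := (rank _).isLt
  lab_lt e e' h' := h.lab_lt e e' h'
  lab_eq e e' h1 h2 := h.lab_eq e e' (Fin.ext h1) h2
  exists_tgt_eq e r hr hn := by
    set v := rank.symm ⟨r, hn⟩ with hv
    have hrv : rank v = ⟨r, hn⟩ := by simp [hv]
    have hpos : G.inDeg v ≠ 0 := fun h0 => by
      have := h.sources_first v (G.tgt e) h0 (inDeg_pos e)
      rw [hrv] at this
      exact absurd (Fin.lt_def.1 this) (by simpa [ranked] using hr)
    obtain ⟨⟨e', he'⟩⟩ : Nonempty {e : E // G.tgt e = v} := by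
      by_contra hc
      rw [not_nonempty_iff] at hc
      exact hpos (Nat.card_of_isEmpty)
    exact ⟨e', by simp [ranked, he', hrv]⟩

/-- An edge that is not the first of its path follows another one, so its source is an internal
vertex of the path. -/
theorem IsPathDecomposition.head_or (h : G.IsPathDecomposition D) (e : E) :
    (∃ p ∈ D, e ∈ p.head?) ∨ (G.inDeg (G.src e) = 1 ∧ G.outDeg (G.src e) = 1 ∧
      ∃ e', G.tgt e' = G.src e) := by
  obtain ⟨p, hp, he⟩ := List.mem_flatten.1 (h.cover e)
  obtain ⟨l₁, l₂, rfl⟩ := List.mem_iff_append.1 he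
  rcases List.eq_nil_or_concat' l₁ with rfl | ⟨l, e', rfl⟩
  · exact .inl ⟨_, hp, by simp⟩
  · right
    have := h.path _ hp
    rw [List.append_assoc] at this
    have := (List.isChain_append.1 this).2.1
    simp only [List.cons_append, List.nil_append, List.isChain_cons_cons] at this
    obtain ⟨⟨h1, h2, h3⟩, -⟩ := this
    rw [h1] at h2 h3
    exact ⟨h2, h3, e', h1⟩

theorem IsPathDecomposition.last_or (h : G.IsPathDecomposition D) (e : E) :
    (∃ p ∈ D, e ∈ p.getLast?) ∨ (G.inDeg (G.tgt e) = 1 ∧ G.outDeg (G.tgt e) = 1 ∧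
      ∃ e', G.src e' = G.tgt e) := by
  obtain ⟨p, hp, he⟩ := List.mem_flatten.1 (h.cover e)
  obtain ⟨l₁, l₂, rfl⟩ := List.mem_iff_append.1 he
  rcases l₂ with _ | ⟨e', l⟩
  · exact .inl ⟨_, hp, by simp⟩
  · right
    have := (List.isChain_append.1 (h.path _ hp)).2.1
    simp only [List.isChain_cons_cons] at this
    obtain ⟨⟨h1, h2, h3⟩, -⟩ := this
    exact ⟨h2, h3, e', h1.symm⟩

open Classical in
/-- The ranks of the ends of the paths. -/
noncomputable def endpointRanks (G : LabelledGraph V E σ) (rank : V ≃ Fin n) (D : List (List E)) :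
    Finset ℕ :=
  (D.filterMap (fun p => p.head?.map (fun e => (rank (G.src e) : ℕ)))).toFinset ∪
    (D.filterMap (fun p => p.getLast?.map (fun e => (rank (G.tgt e) : ℕ)))).toFinset

theorem card_endpointRanks_le : (G.endpointRanks rank D).card ≤ 2 * D.length := by
  refine (Finset.card_union_le _ _).trans ?_
  have h1 := (List.toFinset_card_le
    (D.filterMap (fun p => p.head?.map (fun e => (rank (G.src e) : ℕ))))).trans
    (List.length_filterMap_le _ _)
  have h2 := (List.toFinset_card_le
    (D.filterMap (fun p => p.getLast?.map (fun e => (rank (G.tgt e) : ℕ))))).trans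
    (List.length_filterMap_le _ _)
  omega

theorem mem_endpointRanks {v : V} :
    (rank v : ℕ) ∈ G.endpointRanks rank D ↔ G.IsEndpoint D v := by
  simp only [endpointRanks, Finset.mem_union, List.mem_toFinset, List.mem_filterMap,
    Option.map_eq_some_iff, IsEndpoint, Option.mem_def, Fin.val_inj, rank.injective.eq_iff]
  constructor
  · rintro (⟨p, hp, e, h⟩ | ⟨p, hp, e, h⟩)
    · exact ⟨p, hp, .inl ⟨e, h⟩⟩
    · exact ⟨p, hp, .inr ⟨e, h⟩⟩
  · rintro ⟨p, hp, ⟨e, h⟩ | ⟨e, h⟩⟩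
    · exact .inl ⟨p, hp, e, h⟩
    · exact .inr ⟨p, hp, e, h⟩

theorem IsPathDecomposition.deg_src (h : G.IsPathDecomposition D) {e : E}
    (he : ¬ G.IsEndpoint D (G.src e)) :
    G.inDeg (G.src e) = 1 ∧ G.outDeg (G.src e) = 1 ∧ ∃ e', G.tgt e' = G.src e := by
  rcases h.head_or e with ⟨p, hp, hep⟩ | h
  · exact absurd ⟨p, hp, .inl ⟨e, hep, rfl⟩⟩ he
  · exact h

theorem IsPathDecomposition.deg_tgt (h : G.IsPathDecomposition D) {e : E}
    (he : ¬ G.IsEndpoint D (G.tgt e)) :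
    G.inDeg (G.tgt e) = 1 ∧ G.outDeg (G.tgt e) = 1 ∧ ∃ e', G.src e' = G.tgt e := by
  rcases h.last_or e with ⟨p, hp, hep⟩ | h
  · exact absurd ⟨p, hp, .inr ⟨e, hep, rfl⟩⟩ he
  · exact h

theorem IsPathDecomposition.isPathLike (h : G.IsPathDecomposition D)
    (hi : G.IsIdentifier D ident) :
    (G.ranked rank).IsPathLike (G.endpointRanks rank D) (identOfRank rank ident) where
  src_unique e e' he h' := by
    have he := (mem_endpointRanks (G := G) (D := D)).not.1 he
    exact eq_of_outDeg_eq_one (h.deg_src he).2.1 (rank.injective (Fin.ext h')) rfl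
  tgt_unique e e' he h' := by
    have he := (mem_endpointRanks (G := G) (D := D)).not.1 he
    exact eq_of_inDeg_eq_one (h.deg_tgt he).1 (rank.injective (Fin.ext h')) rfl
  exists_tgt_eq e he := by
    obtain ⟨e', he'⟩ := (h.deg_src ((mem_endpointRanks (G := G) (D := D)).not.1 he)).2.2
    exact ⟨e', by simp [ranked, he']⟩
  exists_src_eq e he := by
    obtain ⟨e', he'⟩ := (h.deg_tgt ((mem_endpointRanks (G := G) (D := D)).not.1 he)).2.2
    exact ⟨e', by simp [ranked, he']⟩
  ident_tgt e hs ht := by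
    have := hi e ((mem_endpointRanks (G := G) (D := D)).not.1 hs)
      ((mem_endpointRanks (G := G) (D := D)).not.1 ht)
    simpa [ranked, identOfRank_rank] using this

/-- Endpoints may have large degree, but an edge leaving one is either the first of its path or
leaves a vertex of out-degree 1, and dually for edges entering. With at most `2 * D.length`
endpoints this gives two edges per path, plus one outgoing and one incoming edge per endpoint. -/
theorem IsPathDecomposition.exists_endpoint_edges [Fintype E] (h : G.IsPathDecomposition D) :
    ∃ EE : Finset E, (∀ e, (G.ranked rank).src e ∈ G.endpointRanks rank D ∨
      (G.ranked rank).tgt e ∈ G.endpointRanks rank D → e ∈ EE) ∧ EE.card ≤ 6 * D.length := by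
  classical
  let A : Finset E := Finset.univ.filter (fun e => G.outDeg (G.src e) = 1 ∧
    (rank (G.src e) : ℕ) ∈ G.endpointRanks rank D)
  let B : Finset E := Finset.univ.filter (fun e => G.inDeg (G.tgt e) = 1 ∧
    (rank (G.tgt e) : ℕ) ∈ G.endpointRanks rank D)
  have hA : A.card ≤ (G.endpointRanks rank D).card := by
    apply Finset.card_le_card_of_injOn (fun e => (rank (G.src e) : ℕ))
    · intro e he
      exact (Finset.mem_filter.1 he).2.2
    · intro e he e' he' hee
      exact eq_of_outDeg_eq_one (Finset.mem_filter.1 he').2.1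
        (rank.injective (Fin.ext hee)) rfl
  have hB : B.card ≤ (G.endpointRanks rank D).card := by
    apply Finset.card_le_card_of_injOn (fun e => (rank (G.tgt e) : ℕ))
    · intro e he
      exact (Finset.mem_filter.1 he).2.2
    · intro e he e' he' hee
      exact eq_of_inDeg_eq_one (Finset.mem_filter.1 he').2.1
        (rank.injective (Fin.ext hee)) rfl
  have hE := card_endpointRanks_le (G := G) (rank := rank) (D := D)
  refine ⟨(D.filterMap List.head?).toFinset ∪ (D.filterMap List.getLast?).toFinset ∪ A ∪ B,
    ?_, ?_⟩
  · rintro e (he | he)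
    · rcases h.head_or e with ⟨p, hp, hep⟩ | h'
      · have : e ∈ (D.filterMap List.head?).toFinset :=
          List.mem_toFinset.2 (List.mem_filterMap.2 ⟨p, hp, hep⟩)
        simp only [Finset.mem_union, this, true_or]
      · have : e ∈ A := Finset.mem_filter.2 ⟨Finset.mem_univ _, h'.2.1, he⟩
        simp only [Finset.mem_union, this, true_or, or_true]
    · rcases h.last_or e with ⟨p, hp, hep⟩ | h'
      · have : e ∈ (D.filterMap List.getLast?).toFinset :=
          List.mem_toFinset.2 (List.mem_filterMap.2 ⟨p, hp, hep⟩)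
        simp only [Finset.mem_union, this, true_or, or_true]
      · have : e ∈ B := Finset.mem_filter.2 ⟨Finset.mem_univ _, h'.1, he⟩
        simp only [Finset.mem_union, this, or_true]
  · have h1 := (List.toFinset_card_le (D.filterMap List.head?)).trans
      (List.length_filterMap_le _ _)
    have h2 := (List.toFinset_card_le (D.filterMap List.getLast?)).trans
      (List.length_filterMap_le _ _)
    have u1 := Finset.card_union_le ((D.filterMap List.head?).toFinset ∪
      (D.filterMap List.getLast?).toFinset ∪ A) B
    have u2 := Finset.card_union_le ((D.filterMap List.head?).toFinset ∪
      (D.filterMap List.getLast?).toFinset) A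
    have u3 := Finset.card_union_le (D.filterMap List.head?).toFinset
      (D.filterMap List.getLast?).toFinset
    omega

/-- Sources outside `Ep` have one out-edge each, so if two of them have consecutive ranks, their
edges are adjacent in the sorted list, and different labels mark a run boundary. -/
theorem IsBWT.exists_changes {B : List (Fin σ)} (hB : G.IsBWT rank B) (Ep : Finset ℕ)
    (hu : ∀ e e', (G.ranked rank).src e ∉ Ep → (G.ranked rank).src e' = (G.ranked rank).src e →
      e' = e) :
    ∃ Ch : List (E × E), Ch.length ≤ runCount B ∧
      ∀ e e', (G.ranked rank).src e ∉ Ep → (G.ranked rank).src e' ∉ Ep →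
        (G.ranked rank).src e' = (G.ranked rank).src e + 1 →
        (G.ranked rank).lab e ≠ (G.ranked rank).lab e' → (e, e') ∈ Ch := by
  obtain ⟨es, hnd, hmem, hpw, rfl⟩ := hB
  refine ⟨labelChanges G.lab es, length_labelChanges_le _ _, fun e e' he he' hs hl => ?_⟩
  have hle : es.Pairwise (fun e e' => (G.ranked rank).src e ≤ (G.ranked rank).src e') := by
    refine hpw.imp fun {a b} h => ?_
    rcases h with h | ⟨h, -⟩
    · exact (Fin.lt_def.1 h).le
    · simp [ranked, h]
  obtain ⟨l₁, l₂, rfl⟩ := List.mem_iff_append.1 (hmem e)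
  rw [List.pairwise_append, List.pairwise_cons] at hle
  obtain ⟨-, ⟨-, hle₂⟩, hle₁⟩ := hle
  have hmem' := hmem e'
  rw [List.mem_append, List.mem_cons] at hmem'
  rcases hmem' with h | rfl | h
  · have := hle₁ e' h e (by simp)
    omega
  · omega
  rcases l₂ with _ | ⟨y, l⟩
  · simp at h
  -- The edge `y` following `e` has its source between two consecutive ranks, hence at one of them,
  -- where the out-edge is unique.
  have hye : y = e' := by
    rcases List.mem_cons.1 h with h | h
    · exact h.symm
    · have h1 := (List.pairwise_cons.1 hle₂).1 e' h
      have h2 : (G.ranked rank).src e ≤ (G.ranked rank).src y := by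
        have := (List.pairwise_append.1 hpw).2.1
        rcases (List.pairwise_cons.1 this).1 y (by simp) with h | ⟨h, -⟩
        · exact (Fin.lt_def.1 h).le
        · simp [ranked, h]
      rcases h2.eq_or_lt with h2 | h2
      · have := hu e y he h2.symm
        subst this
        simp [List.nodup_append] at hnd
      · exact hu e' y he' (by omega)
  subst hye
  exact mem_labelChanges G.lab (fun h => hl (congrArg Fin.val h)) l₁ l

/-- The breakpoints of a graph: linearly many in the number of runs and paths. -/
theorem exists_breakpoints [Fintype E] {B : List (Fin σ)} (hW : G.IsWheelerOrder rank)
    (hB : G.IsBWT rank B) (hD : G.IsPathDecomposition D) (hi : G.IsIdentifier D ident) :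
    ∃ S : Finset ℕ, 0 ∈ S ∧ (∀ x ∈ S, x = 0 ∨ x < σ * n) ∧
      (∀ a j, j < n → (G.ranked rank).IsKey (G.endpointRanks rank D) a j → a * n + j ∈ S) ∧
      S.card ≤ 28 * max 1 (runCount B + D.length) := by
  classical
  have hX := hW.isWheeler_ranked
  have hP := hD.isPathLike (rank := rank) hi
  obtain ⟨EE, hEE, hEEc⟩ := hD.exists_endpoint_edges (rank := rank)
  obtain ⟨Ch, hChc, hCh⟩ := hB.exists_changes _ hP.src_unique
  obtain ⟨Z, hZ, hZc⟩ := RankedEdges.exists_special_superset hX hP EE hEE Ch hCh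
  obtain ⟨S, h0, hlt, hS, hSc⟩ := RankedEdges.exists_keys hX hZ (σ := σ)
    (fun e => (G.lab e).isLt)
  refine ⟨S, h0, hlt, hS, ?_⟩
  have hl : (Finset.univ.image (G.ranked rank).lab).card ≤ runCount B := by
    refine le_trans ?_ (card_toFinset_le_runCount B)
    refine Finset.card_le_card_of_surjOn (fun a : Fin σ => (a : ℕ)) ?_
    intro x hx
    simp only [Finset.coe_image, Set.mem_image, Finset.coe_univ, Set.mem_univ, true_and] at hx
    obtain ⟨e, rfl⟩ := hx
    obtain ⟨es, -, hmem, -, rfl⟩ := hB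
    exact ⟨G.lab e, by simpa using ⟨e, hmem e, rfl⟩, rfl⟩
  have hE := card_endpointRanks_le (G := G) (rank := rank) (D := D)
  omega

theorem Walk.append {u v x : V} {P Q : List (Fin σ)} (h : G.Walk u P v) (h' : G.Walk v Q x) :
    G.Walk u (P ++ Q) x := by
  induction h with
  | nil u => exact h'
  | cons e P v _ ih => exact Walk.cons e _ _ (ih h')

theorem Walk.exists_of_append {u x : V} {P Q : List (Fin σ)} (h : G.Walk u (P ++ Q) x) :
    ∃ v, G.Walk u P v ∧ G.Walk v Q x := by
  induction P generalizing u with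
  | nil => exact ⟨u, .nil u, h⟩
  | cons a P ih =>
    cases h with
    | cons e _ _ h =>
      obtain ⟨v, h1, h2⟩ := ih h
      exact ⟨v, .cons e _ _ h1, h2⟩

theorem Walk.eq_of_nil {u v : V} (h : G.Walk u [] v) : u = v := by
  cases h
  rfl

theorem reached_append_singleton {P : List (Fin σ)} {a : Fin σ} {v : V} :
    G.Reached (P ++ [a]) v ↔ ∃ e, G.lab e = a ∧ G.Reached P (G.src e) ∧ G.tgt e = v := by
  constructor
  · rintro ⟨u, h⟩
    obtain ⟨x, h1, h2⟩ := h.exists_of_append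
    cases h2 with
    | cons e _ _ h =>
      exact ⟨e, rfl, ⟨u, h1⟩, h.eq_of_nil⟩
  · rintro ⟨e, rfl, ⟨u, h⟩, rfl⟩
    exact ⟨u, h.append (.cons e _ _ (.nil _))⟩

end LabelledGraph

/-! ### Predecessors through a trie of samples -/

namespace Predecessor

/-- The number of samples (every `L`-th of the `m` keys, except the first key) below `y`. -/
def sampleCount (K : ℕ → ℕ) (m L y : ℕ) : ℕ :=
  Nat.findGreatest (fun i => i * L < m ∧ K (i * L) < y) m

/-- The trie node for the block number `q` of length `2 ^ e`. -/
def node (L q e : ℕ) : ℕ := q * (L + 1) + e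

/-- The trie nodes whose blocks contain a sample. -/
def nodes (K : ℕ → ℕ) (m L : ℕ) : Finset ℕ :=
  ((Finset.Icc 1 ((m - 1) / L)) ×ˢ Finset.range (L + 1)).image
    (fun q => node L (K (q.1 * L) / 2 ^ q.2) q.2)

/-- The first sample that is not below the block of a node. -/
def nodeMin (K : ℕ → ℕ) (m L v : ℕ) : ℕ :=
  K ((sampleCount K m L (v / (L + 1) * 2 ^ (v % (L + 1))) + 1) * L)

/-- The start of the bucket that precedes the block of a node. -/
def nodeBefore (K : ℕ → ℕ) (m L v : ℕ) : ℕ :=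
  sampleCount K m L (v / (L + 1) * 2 ^ (v % (L + 1))) * L

/-- The start of the last bucket that begins in or before the block of a node. -/
def nodeAfter (K : ℕ → ℕ) (m L v : ℕ) : ℕ :=
  sampleCount K m L ((v / (L + 1) + 1) * 2 ^ (v % (L + 1))) * L

/-- `K 0 < … < K (m - 1)` are keys of `L` bits, the first one being `0`. -/
structure IsKeys (K : ℕ → ℕ) (m L : ℕ) : Prop where
  pos : 0 < m
  length_pos : 0 < L
  zero : K 0 = 0
  strictMono : ∀ i j, i < j → j < m → K i < K j
  lt : ∀ i, K i < 2 ^ L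

variable {K : ℕ → ℕ} {m L : ℕ}

theorem node_div {q e : ℕ} (he : e ≤ L) : node L q e / (L + 1) = q := by
  rw [node, Nat.mul_comm, Nat.mul_add_div (Nat.succ_pos L), Nat.div_eq_of_lt (by omega)]
  rfl

theorem node_mod {q e : ℕ} (he : e ≤ L) : node L q e % (L + 1) = e := by
  rw [node, Nat.mul_comm, Nat.mul_add_mod, Nat.mod_eq_of_lt (by omega)]

theorem node_lt {x e : ℕ} (hx : x < 2 ^ L) (he : e ≤ L) : node L (x / 2 ^ e) e < 2 ^ (2 * L) := by
  have h1 : x / 2 ^ e + 1 ≤ 2 ^ L := (Nat.div_le_self x (2 ^ e)).trans_lt hx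
  have h2 : L + 1 ≤ 2 ^ L := Nat.lt_two_pow_self
  have h3 := Nat.mul_le_mul h1 h2
  rw [two_mul, pow_add]
  unfold node
  nlinarith

theorem lt_of_mem_nodes (h : IsKeys K m L) {v : ℕ} (hv : v ∈ nodes K m L) : v < 2 ^ (2 * L) := by
  obtain ⟨⟨i, e⟩, hi, rfl⟩ := Finset.mem_image.1 hv
  simp only [Finset.mem_product, Finset.mem_range] at hi
  exact node_lt (h.lt _) (by omega)

/-- There are `(m - 1) / L` samples after the first key, each on `L + 1` levels; sampling cancels
the depth of the trie. -/
theorem card_nodes_le (K : ℕ → ℕ) (m L : ℕ) : (nodes K m L).card ≤ 2 * m := by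
  refine Finset.card_image_le.trans ?_
  rw [Finset.card_product, Finset.card_range, Nat.card_Icc, Nat.add_sub_cancel, Nat.mul_add,
    Nat.mul_one]
  have h1 := Nat.div_mul_le_self (m - 1) L
  have h2 := Nat.div_le_self (m - 1) L
  omega

theorem mul_lt_iff (h : IsKeys K m L) {i : ℕ} : i * L < m ↔ i ≤ (m - 1) / L := by
  rw [Nat.le_div_iff_mul_le h.length_pos]
  have := h.pos
  omega

theorem mem_nodes (h : IsKeys K m L) {q e : ℕ} (he : e ≤ L) :
    node L q e ∈ nodes K m L ↔ ∃ i, 1 ≤ i ∧ i * L < m ∧ K (i * L) / 2 ^ e = q := by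
  simp only [nodes, Finset.mem_image, Finset.mem_product, Finset.mem_range, Finset.mem_Icc,
    Prod.exists, mul_lt_iff h]
  constructor
  · rintro ⟨i, e', ⟨⟨h1, h2⟩, h3⟩, h4⟩
    have h5 : e' = e := by
      rw [← node_mod (q := K (i * L) / 2 ^ e') (show e' ≤ L by omega), h4, node_mod he]
    subst h5
    refine ⟨i, h1, h2, ?_⟩
    rw [← node_div (q := K (i * L) / 2 ^ e') he, h4, node_div he]
  · rintro ⟨i, h1, h2, h3⟩
    exact ⟨i, e, ⟨⟨h1, h2⟩, by omega⟩, by rw [h3]⟩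

theorem IsKeys.le_of_le (h : IsKeys K m L) {i j : ℕ} (hij : i ≤ j) (hj : j < m) : K i ≤ K j := by
  rcases hij.eq_or_lt with rfl | hlt
  · exact le_rfl
  · exact (h.strictMono _ _ hlt hj).le

theorem sampleCount_congr {y y' : ℕ}
    (h : ∀ i, 1 ≤ i → i * L < m → (K (i * L) < y ↔ K (i * L) < y')) :
    sampleCount K m L y = sampleCount K m L y' := by
  have aux : ∀ y y', (∀ i, 1 ≤ i → i * L < m → (K (i * L) < y ↔ K (i * L) < y')) →
      sampleCount K m L y ≤ sampleCount K m L y' := by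
    intro y y' h
    rcases Nat.eq_zero_or_pos (sampleCount K m L y) with h0 | h0
    · omega
    · obtain ⟨h1, h2⟩ := Nat.findGreatest_of_ne_zero (P := fun i => i * L < m ∧ K (i * L) < y)
        (n := m) rfl h0.ne'
      exact Nat.le_findGreatest (Nat.findGreatest_le m) ⟨h1, (h _ h0 h1).1 h2⟩
  exact le_antisymm (aux _ _ h) (aux _ _ fun i h1 h2 => (h i h1 h2).symm)

theorem sampleCount_spec (h : IsKeys K m L) {y : ℕ} (hy : 0 < y) :
    sampleCount K m L y * L < m ∧ K (sampleCount K m L y * L) < y := by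
  rcases Nat.eq_zero_or_pos (sampleCount K m L y) with h0 | h0
  · rw [h0, Nat.zero_mul, h.zero]
    exact ⟨h.pos, hy⟩
  · exact Nat.findGreatest_of_ne_zero (P := fun i => i * L < m ∧ K (i * L) < y) (n := m) rfl h0.ne'

theorem sampleCount_mul_le (h : IsKeys K m L) (y : ℕ) : sampleCount K m L y * L ≤ m := by
  rcases Nat.eq_zero_or_pos y with rfl | hy
  · have : sampleCount K m L 0 = 0 := by simp [sampleCount, Nat.findGreatest_eq_zero_iff]
    simp [this]
  · exact (sampleCount_spec h hy).1.le

theorem le_key_of_sampleCount_lt (h : IsKeys K m L) {i y : ℕ} (hi : sampleCount K m L y < i)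
    (him : i * L < m) : y ≤ K (i * L) := by
  have h1 : i ≤ m := by
    have := Nat.le_mul_of_pos_right i h.length_pos
    omega
  have := Nat.findGreatest_is_greatest (P := fun i => i * L < m ∧ K (i * L) < y) hi h1
  simp only [not_and, not_lt] at this
  exact this him

theorem key_lt_of_le_sampleCount (h : IsKeys K m L) {i y : ℕ} (hi : 1 ≤ i)
    (hiy : i ≤ sampleCount K m L y) : K (i * L) < y := by
  obtain ⟨h1, h2⟩ := Nat.findGreatest_of_ne_zero (P := fun i => i * L < m ∧ K (i * L) < y)
    (n := m) (m := sampleCount K m L y) rfl (by omega)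
  exact (h.le_of_le (Nat.mul_le_mul_right L hiy) h1).trans_lt h2

/-- The deepest node on the search path of `x` determines the bucket of `x`. -/
theorem sampleCount_succ_mul (h : IsKeys K m L) {x e : ℕ} (he : e ≤ L)
    (hin : node L (x / 2 ^ e) e ∈ nodes K m L)
    (hout : e = 0 ∨ node L (x / 2 ^ (e - 1)) (e - 1) ∉ nodes K m L) :
    sampleCount K m L (x + 1) * L =
      if x < nodeMin K m L (node L (x / 2 ^ e) e) then nodeBefore K m L (node L (x / 2 ^ e) e)
      else nodeAfter K m L (node L (x / 2 ^ e) e) := by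
  simp only [nodeMin, nodeBefore, nodeAfter, node_div he, node_mod he]
  set q := x / 2 ^ e with hq
  set g := sampleCount K m L (q * 2 ^ e) with hg
  have hpow : 0 < 2 ^ e := Nat.two_pow_pos e
  have hqx : q * 2 ^ e ≤ x := Nat.div_mul_le_self x _
  have hxq : x < (q + 1) * 2 ^ e := by
    rw [Nat.succ_mul]; exact Nat.lt_div_mul_add hpow
  obtain ⟨i₀, hi₀, him₀, hiq₀⟩ := (mem_nodes h he).1 hin
  have hi₀l : q * 2 ^ e ≤ K (i₀ * L) := by rw [← hiq₀]; exact Nat.div_mul_le_self _ _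
  have hi₀u : K (i₀ * L) < (q + 1) * 2 ^ e := by
    rw [← hiq₀, Nat.succ_mul]; exact Nat.lt_div_mul_add hpow
  have hgi₀ : g < i₀ := by
    by_contra! hle
    have := key_lt_of_le_sampleCount h hi₀ hle
    omega
  have hgm : (g + 1) * L < m := (Nat.mul_le_mul_right L hgi₀).trans_lt him₀
  have htl : q * 2 ^ e ≤ K ((g + 1) * L) := le_key_of_sampleCount_lt h (Nat.lt_succ_self _) hgm
  have htu : K ((g + 1) * L) < (q + 1) * 2 ^ e :=
    (h.le_of_le (Nat.mul_le_mul_right L hgi₀) him₀).trans_lt hi₀u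
  split_ifs with hlt
  -- Here `x` is below the first sample of the block, so no sample lies between the start of the
  -- block and `x`.
  · congr 1
    apply sampleCount_congr
    intro i hi him
    refine ⟨fun h' => ?_, fun h' => by omega⟩
    by_contra! hle
    have h1 : g + 1 ≤ i := by
      by_contra! hig
      have := key_lt_of_le_sampleCount h hi (show i ≤ g by omega)
      omega
    have := h.le_of_le (Nat.mul_le_mul_right L h1) him
    omega
  -- Here no sample of the block exceeds `x`. For `e = 0` the block is `{x}`. Otherwise the half
  -- containing `x` has no sample while the first sample is at most `x`, so `x` is in the upper
  -- half, which any larger sample of the block would share.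
  · congr 1
    apply sampleCount_congr
    intro i hi him
    refine ⟨fun h' => by omega, fun h' => ?_⟩
    by_contra! hle
    rcases e with _ | e
    · simp at hxq h' hq
      omega
    rcases hout with h0 | hout
    · omega
    rw [Nat.add_sub_cancel, mem_nodes h (by omega)] at hout
    have hdiv : ∀ z, q * 2 ^ (e + 1) ≤ z → z < (q + 1) * 2 ^ (e + 1) →
        2 * q ≤ z / 2 ^ e ∧ z / 2 ^ e ≤ 2 * q + 1 := by
      intro z h1 h2
      rw [Nat.le_div_iff_mul_le (Nat.two_pow_pos e), ← Nat.lt_succ_iff (m := z / 2 ^ e),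
        Nat.div_lt_iff_lt_mul (Nat.two_pow_pos e)]
      rw [pow_succ] at h1 h2
      constructor <;> nlinarith
    have d1 := hdiv _ htl htu
    have d2 := hdiv _ hqx hxq
    have d3 := hdiv (K (i * L)) (by omega) h'
    have m1 : K ((g + 1) * L) / 2 ^ e ≤ x / 2 ^ e := Nat.div_le_div_right (by omega)
    have m2 : x / 2 ^ e ≤ K (i * L) / 2 ^ e := Nat.div_le_div_right (by omega)
    have n1 : K ((g + 1) * L) / 2 ^ e ≠ x / 2 ^ e := fun h' =>
      hout ⟨g + 1, by omega, hgm, h'⟩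
    have n2 : K (i * L) / 2 ^ e ≠ x / 2 ^ e := fun h' => hout ⟨i, hi, him, h'⟩
    omega

/-- The root block contains all keys, so its node is absent only if the first key is the sole
sample. -/
theorem sampleCount_eq_zero (h : IsKeys K m L) {x : ℕ} (hx : x < 2 ^ L)
    (hout : node L (x / 2 ^ L) L ∉ nodes K m L) (y : ℕ) : sampleCount K m L y = 0 := by
  rw [mem_nodes h le_rfl, Nat.div_eq_of_lt hx] at hout
  rw [sampleCount, Nat.findGreatest_eq_zero_iff]
  rintro i hi - ⟨h1, -⟩
  exact hout ⟨i, hi, h1, Nat.div_eq_of_lt (h.lt _)⟩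

/-- An enumeration of a finite set of keys. -/
theorem exists_isKeys (S : Finset ℕ) (h0 : 0 ∈ S) (hL : 0 < L) (hS : ∀ x ∈ S, x < 2 ^ L) :
    ∃ K : ℕ → ℕ, IsKeys K S.card L ∧ (∀ x ∈ S, ∃ i < S.card, K i = x) := by
  have hpos : 0 < S.card := Finset.card_pos.2 ⟨0, h0⟩
  let f := S.orderEmbOfFin rfl
  -- The value 0 past the end keeps all `K i` below `2 ^ L`; the table of `nodeMin` also has entries
  -- for slots without a node.
  let K : ℕ → ℕ := fun i => if h : i < S.card then f ⟨i, h⟩ else 0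
  have hK : ∀ i (h : i < S.card), K i = f ⟨i, h⟩ := fun i h => dif_pos h
  have hsurj : ∀ x ∈ S, ∃ i < S.card, K i = x := by
    intro x hx
    have : x ∈ Set.range f := by
      rw [Finset.range_orderEmbOfFin]
      exact hx
    obtain ⟨⟨i, hi⟩, h⟩ := this
    exact ⟨i, hi, (hK i hi).trans h⟩
  have hmono : ∀ i j, i < j → j < S.card → K i < K j := by
    intro i j hij hj
    rw [hK i (hij.trans hj), hK j hj]
    exact f.strictMono hij
  refine ⟨K, ⟨hpos, hL, ?_, hmono, ?_⟩, hsurj⟩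
  · obtain ⟨i, hi, h⟩ := hsurj 0 h0
    rcases Nat.eq_zero_or_pos i with rfl | hi'
    · exact h
    · have := hmono 0 i hi' hi
      omega
  · intro i
    by_cases h : i < S.card
    · rw [hK i h]
      exact hS _ (Finset.orderEmbOfFin_mem S rfl _)
    · simp only [K, dif_neg h]
      exact Nat.two_pow_pos L

end Predecessor

open Predecessor

/-! ### The stored index and its predecessor search -/

namespace WordRAM

/-- The stored structure: `m` sorted keys of `L` bits with a hashed trie of samples, and a record
for every key. -/
structure Index where
  n : ℕ
  id₀ : ℕ
  m : ℕ
  L : ℕ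
  h : ℕ
  key : ℕ → ℕ
  hash : PerfectHash.Hash
  slot : ℕ → ℕ
  mode : ℕ → ℕ
  lastSrc : ℕ → ℕ
  lastTgt : ℕ → ℕ
  lastId : ℕ → ℕ
  first : ℕ → ℕ
  next : ℕ → ℕ

namespace Index

/-- The tables of the structure. -/
def get (I : Index) : ℕ → ℕ → ℕ
  | 0, _ => I.n
  | 1, _ => I.id₀
  | 2, _ => I.m
  | 3, _ => I.L
  | 4, _ => 2 ^ I.h
  | 5, _ => I.hash.prime
  | 6, _ => I.hash.mult
  | 7, _ => I.hash.size
  | 8, b => I.hash.mult₂ b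
  | 9, b => I.hash.size₂ b
  | 10, b => I.hash.offset b
  | 11, t => I.slot t
  | 12, t => nodeMin I.key I.m I.L (I.slot t)
  | 13, t => nodeBefore I.key I.m I.L (I.slot t)
  | 14, t => nodeAfter I.key I.m I.L (I.slot t)
  | 15, i => I.key i
  | 16, i => I.mode i
  | 17, i => I.lastSrc i
  | 18, i => I.lastTgt i
  | 19, i => I.lastId i
  | 20, i => I.first i
  | _, i => I.next i

/-- The lengths of the tables. -/
def len (I : Index) (k : ℕ) : ℕ :=
  if k < 8 then 1 else if k < 11 then I.hash.size else if k < 15 then I.hash.total else I.m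

/-- The part of the structure used by predecessor searches is as it should be. -/
structure IsCorrect (I : Index) (w : ℕ) : Prop where
  keys : IsKeys I.key I.m I.L
  perfect : I.hash.IsPerfect I.hash.prime (nodes I.key I.m I.L)
  lt_prime : 2 ^ (2 * I.L) < I.hash.prime
  prime_le : I.hash.prime ≤ 2 ^ (2 * I.L + 1)
  slot_pos : ∀ x ∈ nodes I.key I.m I.L, I.slot (I.hash.pos x) = x
  slot_or : ∀ t, I.slot t ∈ nodes I.key I.m I.L ∨ I.slot t = I.hash.prime
  lt_step : I.L < 2 ^ (I.h + 1)
  step_le : 2 ^ I.h ≤ I.L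
  m_le : I.m ≤ 2 ^ I.L
  le_word : 4 * I.L + 10 ≤ w

end Index

/-- `s'` has the same input as `s` and the same contents of the first `k` registers. -/
def Agree (k : ℕ) (s s' : State) : Prop := (∀ r < k, s'.reg r = s.reg r) ∧ s'.input = s.input

theorem State.reg_set (s : State) (d x r : ℕ) :
    (s.set d x).reg r = if r = d then x else s.reg r := by
  simp [State.set, Function.update_apply]

@[simp] theorem State.input_set (s : State) (d x : ℕ) : (s.set d x).input = s.input := rfl

theorem Agree.refl (k : ℕ) (s : State) : Agree k s s := ⟨fun _ _ => rfl, rfl⟩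

theorem Agree.trans {k : ℕ} {s s' s'' : State} (h : Agree k s s') (h' : Agree k s' s'') :
    Agree k s s'' := ⟨fun r hr => (h'.1 r hr).trans (h.1 r hr), h'.2.trans h.2⟩

theorem Agree.mono {k l : ℕ} {s s' : State} (h : Agree k s s') (hl : l ≤ k) : Agree l s s' :=
  ⟨fun r hr => h.1 r (hr.trans_le hl), h.2⟩

theorem Agree.set {k d x : ℕ} {s s' : State} (h : Agree k s s') (hd : k ≤ d) :
    Agree k s (s'.set d x) :=
  ⟨fun r hr => by rw [State.reg_set, if_neg (by omega), h.1 r hr], h.2⟩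

/-- Look up the trie node of level `reg 13` for the key `reg 8`: its slot in `reg 15`, whether it
is present in `reg 14`. -/
def lookup : Cmd :=
  .seq (fetch 16 5 4) <| .seq (.instr (.op 17 .shr 8 13)) <| .seq (fetch 18 3 4) <|
  .seq (.instr (.op 18 .add 18 5)) <| .seq (.instr (.op 17 .mul 17 18)) <|
  .seq (.instr (.op 17 .add 17 13)) <|
  .seq (fetch 18 6 4) <| .seq (.instr (.op 18 .mul 18 17)) <| .seq (.instr (.op 18 .mod 18 16)) <|
  .seq (fetch 19 7 4) <| .seq (.instr (.op 18 .mod 18 19)) <|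
  .seq (fetch 19 8 18) <| .seq (.instr (.op 19 .mul 19 17)) <|
  .seq (.instr (.op 19 .mod 19 16)) <| .seq (fetch 20 9 18) <|
  .seq (.instr (.op 19 .mod 19 20)) <| .seq (fetch 20 10 18) <|
  .seq (.instr (.op 15 .add 20 19)) <| .seq (fetch 20 11 15) <|
  .ite (.eq 20 17) (.instr (.const 14 1)) (.instr (.copy 14 4))

/-- Binary search for the last number that passes a test, leaving it in `reg 10`. The test gets
its argument in `reg 12` and sets `reg 14`. -/
def search (test : Cmd) : Cmd :=
  .seq (.instr (.copy 10 4)) <| .seq (fetch 11 4 4) <|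
  .loop (.lt 4 11) <| .seq (.instr (.op 12 .add 10 11)) <| .seq test <|
    .seq (.ite (.eq 14 5) (.instr (.copy 10 12)) (.instr .nop)) (.instr (.op 11 .shr 11 5))

/-- Whether the first `reg 12` levels of the search path of `reg 8` have absent nodes. -/
def trieTest : Cmd :=
  .seq (fetch 16 3 4) <| .ite (.lt 16 12) (.instr (.copy 14 4))
    (.seq (.instr (.op 13 .sub 12 5)) <| .seq lookup (.instr (.op 14 .sub 5 14)))

/-- Whether the key of number `reg 9 + reg 12` is at most `reg 8`. -/
def bucketTest : Cmd :=
  .seq (.instr (.op 16 .add 9 12)) <| .seq (fetch 17 2 4) <|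
  .ite (.lt 16 17) (.seq (fetch 17 15 16) <|
    .ite (.lt 8 17) (.instr (.copy 14 4)) (.instr (.const 14 1))) (.instr (.copy 14 4))

/-- Find the number of the last key that is at most `reg 8`, leaving it in `reg 9`. -/
def predecessor : Cmd :=
  .seq (search trieTest) <| .seq (.instr (.copy 13 10)) <| .seq lookup <|
  .seq (.ite (.eq 14 5) (.seq (fetch 16 12 15) <| .ite (.lt 8 16) (fetch 9 13 15) (fetch 9 14 15))
    (.instr (.copy 9 4))) <|
  .seq (search bucketTest) (.instr (.op 9 .add 9 10))

variable {I : Index} {w : ℕ} {mem : List ℕ}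

namespace Index.IsCorrect

theorem pow_le (hI : I.IsCorrect w) {k : ℕ} (hk : k ≤ 4 * I.L + 10) : 2 ^ k ≤ 2 ^ w :=
  Nat.pow_le_pow_right (by norm_num) (hk.trans hI.le_word)

/-- Empty slots hold the prime, which exceeds every node number, so one comparison decides
membership. -/
theorem slot_pos_eq_iff (hI : I.IsCorrect w) {x : ℕ} (hx : x < I.hash.prime) :
    I.slot (I.hash.pos x) = x ↔ x ∈ nodes I.key I.m I.L := by
  refine ⟨fun h => ?_, hI.slot_pos x⟩
  rcases hI.slot_or (I.hash.pos x) with h' | h'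
  · rwa [h] at h'
  · omega

theorem total_le (hI : I.IsCorrect w) : I.hash.total ≤ 2 ^ (I.L + 4) := by
  have h1 := hI.perfect.total_le
  have h2 := card_nodes_le I.key I.m I.L
  have h3 := hI.m_le
  have h4 := Nat.one_le_two_pow (n := I.L)
  rw [pow_add]
  omega

end Index.IsCorrect

theorem halts_lookup (hI : I.IsCorrect w) (hm : HasTables w mem I.len I.get 22) {s : State}
    {x e : ℕ} (hx : x < 2 ^ I.L) (he : e ≤ I.L) (h4 : s.reg 4 = 0) (h5 : s.reg 5 = 1)
    (h8 : s.reg 8 = x) (h13 : s.reg 13 = e) :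
    Halts w mem lookup (fun t s' => t ≤ 60 ∧ Agree 14 s s' ∧
      s'.reg 15 = I.hash.pos (node I.L (x / 2 ^ e) e) ∧
      s'.reg 14 = if node I.L (x / 2 ^ e) e ∈ nodes I.key I.m I.L then 1 else 0) s := by
  have hv := node_lt hx he
  set v := node I.L (x / 2 ^ e) e with hvdef
  have hL : I.L < 2 ^ I.L := Nat.lt_two_pow_self
  have hpos2 := hI.perfect.pos_lt v
  have hp0 : 0 < I.hash.prime := (Nat.zero_le _).trans_lt hI.lt_prime
  -- The product of a multiplier and a node number is the largest intermediate value; it accounts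
  -- for the `4 * L` in the word length.
  have hprod : ∀ a b, a < I.hash.prime → b < 2 ^ (2 * I.L) → a * b < 2 ^ w := by
    intro a b ha hb
    have h1 : a * b ≤ 2 ^ (2 * I.L + 1) * 2 ^ (2 * I.L) :=
      Nat.mul_le_mul (ha.le.trans hI.prime_le) hb.le
    rw [← pow_add] at h1
    exact h1.trans_lt ((Nat.pow_lt_pow_right (by norm_num) (Nat.lt_succ_self _)).trans_le
      (hI.pow_le (by omega)))
  have hLw : 2 ^ I.L < 2 ^ w := (Nat.pow_lt_pow_right (by norm_num)
    (Nat.lt_succ_self _)).trans_le (hI.pow_le (by omega))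
  have h2Lw : 2 ^ (2 * I.L) < 2 ^ w := (Nat.pow_lt_pow_right (by norm_num)
    (Nat.lt_succ_self _)).trans_le (hI.pow_le (by omega))
  have hpw : I.hash.prime < 2 ^ w := hI.prime_le.trans_lt
    ((Nat.pow_lt_pow_right (by norm_num) (Nat.lt_succ_self _)).trans_le (hI.pow_le (by omega)))
  have hvw : x / 2 ^ e * (I.L + 1) + e = v := rfl
  have hbk : I.hash.mult * v % I.hash.prime % I.hash.size = I.hash.bucket v := rfl
  have hbk_lt : I.hash.bucket v < I.hash.size := Nat.mod_lt _ hI.perfect.size_pos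
  have hslot : I.hash.offset (I.hash.bucket v) + I.hash.mult₂ (I.hash.bucket v) * v % I.hash.prime %
    I.hash.size₂ (I.hash.bucket v) = I.hash.pos v := rfl
  have htot : I.hash.total < 2 ^ w := hI.total_le.trans_lt
    ((Nat.pow_lt_pow_right (by norm_num) (Nat.lt_succ_self _)).trans_le (hI.pow_le (by omega)))
  refine Halts.seq (Halts.fetch hm (by norm_num) (by norm_num)
    (by simp [Index.len, h4]) ?_)
  refine Halts.seq (Halts.shr (by simp [State.reg_set, h8]; omega) ?_)
  refine Halts.seq (Halts.fetch hm (by norm_num) (by norm_num)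
    (by simp [Index.len, State.reg_set, h4]) ?_)
  simp only [State.reg_set, Index.get, h8, h13, Nat.reduceEqDiff, reduceIte, h4]
  refine Halts.seq (Halts.add (by simp [State.reg_set, h5]; omega) ?_)
  have hm1 : x / 2 ^ e * (I.L + 1) < 2 ^ w := by omega
  refine Halts.seq (Halts.mul (by simpa [State.reg_set, h5] using hm1) ?_)
  refine Halts.seq (Halts.add (by simp [State.reg_set, h5, h13]; omega) ?_)
  simp only [State.reg_set, h5, h13, Nat.reduceEqDiff, reduceIte, hvw]
  refine Halts.seq (Halts.fetch hm (by norm_num) (by norm_num)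
    (by simp [Index.len, State.reg_set, h4]) ?_)
  refine Halts.seq (Halts.mul (by
    simpa [State.reg_set, Index.get] using hprod _ _ hI.perfect.mult_lt hv) ?_)
  refine Halts.seq (Halts.mod (by
    simpa [State.reg_set, Index.get] using hprod _ _ hI.perfect.mult_lt hv) ?_)
  simp only [State.reg_set, Index.get, Nat.reduceEqDiff, reduceIte]
  refine Halts.seq (Halts.fetch hm (by norm_num) (by norm_num)
    (by simp [Index.len, State.reg_set, h4]) ?_)
  refine Halts.seq (Halts.mod (by
    simpa [State.reg_set, Index.get] using (Nat.mod_lt _ hp0).trans hpw) ?_)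
  simp only [State.reg_set, Index.get, Nat.reduceEqDiff, reduceIte, hbk]
  refine Halts.seq (Halts.fetch hm (by norm_num) (by norm_num)
    (by simpa [Index.len, State.reg_set] using hbk_lt) ?_)
  refine Halts.seq (Halts.mul (by
    simpa [State.reg_set, Index.get] using hprod _ _ (hI.perfect.mult₂_lt _) hv) ?_)
  refine Halts.seq (Halts.mod (by
    simpa [State.reg_set, Index.get] using hprod _ _ (hI.perfect.mult₂_lt _) hv) ?_)
  simp only [State.reg_set, Index.get, Nat.reduceEqDiff, reduceIte]
  refine Halts.seq (Halts.fetch hm (by norm_num) (by norm_num)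
    (by simpa [Index.len, State.reg_set] using hbk_lt) ?_)
  refine Halts.seq (Halts.mod (by
    simpa [State.reg_set, Index.get] using (Nat.mod_lt _ hp0).trans hpw) ?_)
  refine Halts.seq (Halts.fetch hm (by norm_num) (by norm_num)
    (by simpa [Index.len, State.reg_set] using hbk_lt) ?_)
  refine Halts.seq (Halts.add (by
    simpa [State.reg_set, Index.get, hslot] using hpos2.trans htot) ?_)
  simp only [State.reg_set, Index.get, Nat.reduceEqDiff, reduceIte, hslot]
  refine Halts.seq (Halts.fetch hm (by norm_num) (by norm_num)
    (by simpa [Index.len, State.reg_set] using hpos2) ?_)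
  simp only [State.reg_set, Index.get, Nat.reduceEqDiff, reduceIte]
  have hiff := hI.slot_pos_eq_iff (hv.trans hI.lt_prime)
  refine Halts.ite (fun hc => ?_) (fun hc => ?_)
  · simp [Cond.holds, State.reg_set] at hc
    refine Halts.const (by omega) ⟨by norm_num, ?_, ?_, ?_⟩
    · repeat' first | exact Agree.refl _ _ | refine Agree.set ?_ (by norm_num)
    · simp [State.reg_set]
    · simp [State.reg_set, hiff.1 hc]
  · simp [Cond.holds, State.reg_set] at hc
    refine Halts.copy ⟨by norm_num, ?_, ?_, ?_⟩
    · repeat' first | exact Agree.refl _ _ | refine Agree.set ?_ (by norm_num)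
    · simp [State.reg_set]
    · simpa [State.reg_set, h4] using fun h => hc (hiff.2 h)

end WordRAM

namespace WordRAM

variable {I : Index} {w : ℕ} {mem : List ℕ}

/-- The loop of `search`. -/
theorem halts_search_loop {test : Cmd} {A : ℕ → Prop} {T M : ℕ} {s : State}
    (hMw : M < 2 ^ w) (h4 : s.reg 4 = 0) (h5 : s.reg 5 = 1)
    (htest : ∀ s' : State, Agree 10 s s' → 1 ≤ s'.reg 12 → s'.reg 12 ≤ M →
      Halts w mem test (fun t s'' => t ≤ T ∧ Agree 13 s' s'' ∧
        (s''.reg 14 = 1 ↔ A (s'.reg 12))) s')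
    (k : ℕ) : ∀ s' : State, Agree 10 s s' → s'.reg 11 = 2 ^ k / 2 → A (s'.reg 10) →
      ¬ A (s'.reg 10 + 2 ^ k) → s'.reg 10 + 2 ^ k ≤ M →
      Halts w mem (.loop (.lt 4 11) <| .seq (.instr (.op 12 .add 10 11)) <| .seq test <|
        .seq (.ite (.eq 14 5) (.instr (.copy 10 12)) (.instr .nop)) (.instr (.op 11 .shr 11 5)))
        (fun t s'' => t ≤ 1 + k * (T + 5) ∧ Agree 10 s s'' ∧ A (s''.reg 10) ∧
          ¬ A (s''.reg 10 + 1)) s' := by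
  induction k with
  | zero =>
    intro s' hs h11 h1 h2 _
    have h4' : s'.reg 4 = 0 := (hs.1 4 (by norm_num)).trans h4
    refine Halts.loop_done ?_ ⟨by omega, hs, h1, by simpa using h2⟩
    simp [Cond.holds, h4', h11]
  -- The invariant is that `A` holds at `reg 10` and fails `2 ^ k` further on. Testing the midpoint
  -- keeps a half with the same property.
  | succ k ih =>
    intro s' hs h11 h1 h2 h3
    have h4' : s'.reg 4 = 0 := (hs.1 4 (by norm_num)).trans h4
    have h5' : s'.reg 5 = 1 := (hs.1 5 (by norm_num)).trans h5
    have hk : 2 ^ (k + 1) / 2 = 2 ^ k := by rw [pow_succ]; omega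
    have hk' : 2 ^ (k + 1) = 2 ^ k + 2 ^ k := by rw [pow_succ]; omega
    have hk0 : 0 < 2 ^ k := Nat.two_pow_pos k
    rw [hk] at h11
    refine Halts.loop_step (by simp [Cond.holds, h4', h11]) ?_
    refine Halts.seq (Halts.add (by rw [h11]; omega) ?_)
    refine Halts.seq ?_
    have hy : (s'.set 12 (s'.reg 10 + s'.reg 11)).reg 12 = s'.reg 10 + 2 ^ k := by
      simp [State.reg_set, h11]
    refine (htest _ (hs.set (by norm_num)) (by rw [hy]; omega) (by rw [hy]; omega)).mono ?_
    rintro t s₁ ⟨ht, hs₁, hf⟩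
    rw [hy] at hf
    have r4 : s₁.reg 4 = 0 := by simp [hs₁.1 4 (by norm_num), State.reg_set, h4']
    have r5 : s₁.reg 5 = 1 := by simp [hs₁.1 5 (by norm_num), State.reg_set, h5']
    have r10 : s₁.reg 10 = s'.reg 10 := by simp [hs₁.1 10 (by norm_num), State.reg_set]
    have r11 : s₁.reg 11 = 2 ^ k := by simp [hs₁.1 11 (by norm_num), State.reg_set, h11]
    have r12 : s₁.reg 12 = s'.reg 10 + 2 ^ k := by rw [hs₁.1 12 (by norm_num), hy]
    have ag : Agree 10 s s₁ := (hs.set (by norm_num)).trans (hs₁.mono (by norm_num))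
    refine Halts.seq ?_
    have hadd : (k + 1) * (T + 5) = k * (T + 5) + (T + 5) := by ring
    have key : ∀ s₂ : State, Agree 10 s s₂ → s₂.reg 11 = 2 ^ k → s₂.reg 5 = 1 → A (s₂.reg 10) →
        ¬ A (s₂.reg 10 + 2 ^ k) → s₂.reg 10 + 2 ^ k ≤ M →
        Halts w mem (.instr (.op 11 .shr 11 5)) (fun t' s'' =>
          Halts w mem (.loop (.lt 4 11) <| .seq (.instr (.op 12 .add 10 11)) <| .seq test <|
            .seq (.ite (.eq 14 5) (.instr (.copy 10 12)) (.instr .nop))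
              (.instr (.op 11 .shr 11 5)))
            (fun t'' s'' => (1 + (1 + (t + (2 + t'))) + t'') ≤ 1 + (k + 1) * (T + 5) ∧
              Agree 10 s s'' ∧ A (s''.reg 10) ∧ ¬ A (s''.reg 10 + 1)) s'') s₂ := by
      intro s₂ hs₂ e11 e5 e1 e2 e3
      refine Halts.shr (by rw [e11]; omega) ?_
      refine (ih _ (hs₂.set (by norm_num)) (by simp [State.reg_set, e11, e5])
        (by simpa [State.reg_set] using e1) (by simpa [State.reg_set] using e2)
        (by simpa [State.reg_set] using e3)).mono ?_
      rintro t'' s₃ ⟨q1, q2, q3, q4⟩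
      exact ⟨by omega, q2, q3, q4⟩
    refine Halts.ite (fun hc => ?_) (fun hc => ?_)
    · simp only [Cond.holds, r5, hf] at hc
      refine Halts.copy (key _ (ag.set (by norm_num)) (by simp [State.reg_set, r11])
        (by simp [State.reg_set, r5]) ?_ ?_ ?_)
      · simpa [State.reg_set, r12] using hc
      · simpa [State.reg_set, r12, add_assoc, ← hk'] using h2
      · simp [State.reg_set, r12]; omega
    · simp only [Cond.holds, r5, hf] at hc
      refine Halts.instr (key s₁ ag r11 r5 ?_ ?_ ?_)
      · rwa [r10]
      · rwa [r10]
      · omega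

/-- Bisection between an argument where `A` holds and one where it fails finds a change from true to
false; `A` need not be monotone. -/
theorem halts_search (hI : I.IsCorrect w) (hm : HasTables w mem I.len I.get 22) {test : Cmd}
    {A : ℕ → Prop} {T : ℕ} {s : State} (hA0 : A 0)
    (hAM : ¬ A (2 ^ (I.h + 1))) (h4 : s.reg 4 = 0) (h5 : s.reg 5 = 1)
    (htest : ∀ s' : State, Agree 10 s s' → 1 ≤ s'.reg 12 → s'.reg 12 ≤ 2 ^ (I.h + 1) →
      Halts w mem test (fun t s'' => t ≤ T ∧ Agree 13 s' s'' ∧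
        (s''.reg 14 = 1 ↔ A (s'.reg 12))) s') :
    Halts w mem (search test) (fun t s' => t ≤ 6 + (I.h + 1) * (T + 5) ∧ Agree 10 s s' ∧
      A (s'.reg 10) ∧ ¬ A (s'.reg 10 + 1)) s := by
  have hM : 2 ^ (I.h + 1) < 2 ^ w := by
    have h1 := hI.step_le
    have h2 : I.L < 2 ^ I.L := Nat.lt_two_pow_self
    have h3 := hI.pow_le (k := I.L + 1) (by omega)
    rw [pow_succ] at h3 ⊢
    omega
  refine Halts.seq (Halts.copy ?_)
  refine Halts.seq (Halts.fetch hm (by norm_num) (by norm_num)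
    (by simp [Index.len, State.reg_set, h4]) ?_)
  refine (halts_search_loop hM h4 h5 htest (I.h + 1) _
    (((Agree.refl _ _).set (by norm_num)).set (by norm_num)) ?_ ?_ ?_ ?_).mono ?_
  · simp [State.reg_set, Index.get, pow_succ]
  · simpa [State.reg_set, h4] using hA0
  · simpa [State.reg_set, h4] using hAM
  · simp [State.reg_set, h4]
  · rintro t s' ⟨h1, h2⟩
    exact ⟨by omega, h2⟩

theorem halts_trieTest (hI : I.IsCorrect w) (hm : HasTables w mem I.len I.get 22) {s : State}
    {x : ℕ} (hx : x < 2 ^ I.L) (h4 : s.reg 4 = 0) (h5 : s.reg 5 = 1) (h8 : s.reg 8 = x)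
    (h12 : 1 ≤ s.reg 12) (h12w : s.reg 12 < 2 ^ w) :
    Halts w mem trieTest (fun t s' => t ≤ 70 ∧ Agree 13 s s' ∧ (s'.reg 14 = 1 ↔
      s.reg 12 ≤ I.L ∧ (s.reg 12 = 0 ∨
        node I.L (x / 2 ^ (s.reg 12 - 1)) (s.reg 12 - 1) ∉ nodes I.key I.m I.L))) s := by
  refine Halts.seq (Halts.fetch hm (by norm_num) (by norm_num)
    (by simp [Index.len, h4]) ?_)
  refine Halts.ite (fun hc => ?_) (fun hc => ?_)
  · simp [Cond.holds, State.reg_set, Index.get] at hc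
    refine Halts.copy ⟨by norm_num, ((Agree.refl _ _).set (by norm_num)).set (by norm_num), ?_⟩
    simp [State.reg_set, h4]
    omega
  · simp [Cond.holds, State.reg_set, Index.get] at hc
    refine Halts.seq (Halts.sub (by simpa [State.reg_set, h5] using h12)
      (by simpa [State.reg_set] using h12w) ?_)
    refine Halts.seq ?_
    refine (halts_lookup hI hm hx (show s.reg 12 - 1 ≤ I.L by omega) (by simp [State.reg_set, h4])
      (by simp [State.reg_set, h5]) (by simp [State.reg_set, h8])
      (by simp [State.reg_set, h5])).mono ?_
    rintro t s' ⟨ht, hag, -, hf⟩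
    have r5 : s'.reg 5 = 1 := by simp [hag.1 5 (by norm_num), State.reg_set, h5]
    have h1w : 1 < 2 ^ w := Nat.one_lt_two_pow (by have := hI.le_word; omega)
    refine Halts.sub (by rw [hf, r5]; split_ifs <;> omega) (by omega) ⟨by omega, ?_, ?_⟩
    · exact ((((Agree.refl _ _).set (by norm_num)).set (by norm_num)).trans
        (hag.mono (by norm_num))).set (by norm_num)
    · simp only [State.reg_set, r5, hf, if_true]
      split_ifs with h
      · simp [h]; omega
      · simp [h, hc]

theorem halts_bucketTest (hm : HasTables w mem I.len I.get 22) {s : State}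
    (h4 : s.reg 4 = 0) (hw : s.reg 9 + s.reg 12 < 2 ^ w) (h1w : 1 < 2 ^ w) :
    Halts w mem bucketTest (fun t s' => t ≤ 70 ∧ Agree 13 s s' ∧ (s'.reg 14 = 1 ↔
      s.reg 9 + s.reg 12 < I.m ∧ I.key (s.reg 9 + s.reg 12) ≤ s.reg 8)) s := by
  refine Halts.seq (Halts.add hw ?_)
  refine Halts.seq (Halts.fetch hm (by norm_num) (by norm_num)
    (by simp [Index.len, State.reg_set, h4]) ?_)
  refine Halts.ite (fun hc => ?_) (fun hc => ?_)
  · simp [Cond.holds, State.reg_set, Index.get] at hc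
    refine Halts.seq (Halts.fetch hm (by norm_num) (by norm_num)
      (by simpa [Index.len, State.reg_set] using hc) ?_)
    refine Halts.ite (fun hc' => ?_) (fun hc' => ?_)
    · simp [Cond.holds, State.reg_set, Index.get] at hc'
      refine Halts.copy ⟨by norm_num, ?_, ?_⟩
      · repeat' first | exact Agree.refl _ _ | refine Agree.set ?_ (by norm_num)
      · simp [State.reg_set, h4]
        omega
    · simp [Cond.holds, State.reg_set, Index.get] at hc'
      refine Halts.const h1w ⟨by norm_num, ?_, ?_⟩
      · repeat' first | exact Agree.refl _ _ | refine Agree.set ?_ (by norm_num)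
      · simp [State.reg_set]
        omega
  · simp [Cond.holds, State.reg_set, Index.get] at hc
    refine Halts.copy ⟨by norm_num, ?_, ?_⟩
    · repeat' first | exact Agree.refl _ _ | refine Agree.set ?_ (by norm_num)
    · simp [State.reg_set, h4]
      omega

/-- The first half of a predecessor search: find the bucket. -/
theorem halts_bucket (hI : I.IsCorrect w) (hm : HasTables w mem I.len I.get 22)
    {Q : ℕ → State → Prop} {s : State} {x T : ℕ} {rest : Cmd} (hx : x < 2 ^ I.L)
    (h4 : s.reg 4 = 0) (h5 : s.reg 5 = 1) (h8 : s.reg 8 = x)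
    (hrest : ∀ s', Agree 9 s s' → s'.reg 9 = sampleCount I.key I.m I.L (x + 1) * I.L →
      Halts w mem rest (fun t s'' => t ≤ T ∧ Q t s'') s')
    (hQ : ∀ t t' s', t ≤ t' → Q t s' → Q t' s') :
    Halts w mem (.seq (search trieTest) <| .seq (.instr (.copy 13 10)) <| .seq lookup <|
      .seq (.ite (.eq 14 5)
        (.seq (fetch 16 12 15) <| .ite (.lt 8 16) (fetch 9 13 15) (fetch 9 14 15))
        (.instr (.copy 9 4))) rest)
      (fun t s'' => t ≤ 80 + (I.h + 1) * 75 + T ∧ Q t s'') s := by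
  -- At a change of `A` from `z` to `z + 1` the node of level `z` is present, or `z = L`, and the
  -- node below it is absent or `z = 0`. This is what `sampleCount_succ_mul` asks for, unless the
  -- root itself is absent.
  let A : ℕ → Prop := fun z => z ≤ I.L ∧ (z = 0 ∨
    node I.L (x / 2 ^ (z - 1)) (z - 1) ∉ nodes I.key I.m I.L)
  have hMw : 2 ^ (I.h + 1) < 2 ^ w := by
    have h1 := hI.step_le
    have h2 : I.L < 2 ^ I.L := Nat.lt_two_pow_self
    have h3 := hI.pow_le (k := I.L + 1) (by omega)
    rw [pow_succ] at h3 ⊢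
    omega
  refine Halts.seq ((halts_search (T := 70) (A := A) hI hm ⟨Nat.zero_le _, .inl rfl⟩
    (fun h => absurd h.1 (by have := hI.lt_step; omega)) h4 h5 ?_).mono ?_)
  · intro s' hs h1 h2
    exact halts_trieTest hI hm hx ((hs.1 4 (by norm_num)).trans h4)
      ((hs.1 5 (by norm_num)).trans h5) ((hs.1 8 (by norm_num)).trans h8) h1 (by omega)
  rintro t s' ⟨ht, hag, hz, hz'⟩
  set z := s'.reg 10 with hzdef
  have r4 : s'.reg 4 = 0 := (hag.1 4 (by norm_num)).trans h4
  have r5 : s'.reg 5 = 1 := (hag.1 5 (by norm_num)).trans h5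
  have r8 : s'.reg 8 = x := (hag.1 8 (by norm_num)).trans h8
  refine Halts.seq (Halts.copy ?_)
  refine Halts.seq ((halts_lookup hI hm hx hz.1 (by simp [State.reg_set, r4])
    (by simp [State.reg_set, r5]) (by simp [State.reg_set, r8])
    (by simp [State.reg_set, ← hzdef])).mono ?_)
  rintro t₁ s₁ ⟨ht₁, hag₁, h15, h14⟩
  have q4 : s₁.reg 4 = 0 := by simp [hag₁.1 4 (by norm_num), State.reg_set, r4]
  have q5 : s₁.reg 5 = 1 := by simp [hag₁.1 5 (by norm_num), State.reg_set, r5]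
  have q8 : s₁.reg 8 = x := by simp [hag₁.1 8 (by norm_num), State.reg_set, r8]
  have ag : Agree 9 s s₁ := ((hag.set (by norm_num)).trans (hag₁.mono (by norm_num))).mono
    (by norm_num)
  refine Halts.seq ?_
  have fin : ∀ t₂ s₂, t₂ ≤ 10 → Agree 9 s₁ s₂ →
      s₂.reg 9 = sampleCount I.key I.m I.L (x + 1) * I.L →
      Halts w mem rest (fun t' s'' => t + (1 + (t₁ + (t₂ + t'))) ≤ 80 + (I.h + 1) * 75 + T ∧
        Q (t + (1 + (t₁ + (t₂ + t')))) s'') s₂ := by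
    intro t₂ s₂ ht₂ hag₂ h9
    refine (hrest s₂ (ag.trans hag₂) h9).mono ?_
    rintro t' s'' ⟨ht', hq⟩
    exact ⟨by omega, hQ _ _ _ (by omega) hq⟩
  by_cases hin : node I.L (x / 2 ^ z) z ∈ nodes I.key I.m I.L
  · have hout : z = 0 ∨ node I.L (x / 2 ^ (z - 1)) (z - 1) ∉ nodes I.key I.m I.L := hz.2
    have hsc := sampleCount_succ_mul hI.keys hz.1 hin hout
    have hsl := hI.slot_pos _ hin
    rw [if_pos hin] at h14
    refine Halts.ite (fun hc => ?_) (fun hc => absurd (h14.trans q5.symm) hc)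
    refine Halts.seq (Halts.fetch hm (by norm_num) (by norm_num)
      (by simpa [Index.len, h15] using hI.perfect.pos_lt _) ?_)
    refine Halts.ite (fun hc => ?_) (fun hc => ?_)
    · simp [Cond.holds, State.reg_set, Index.get, h15, q8, hsl] at hc
      rw [if_pos hc] at hsc
      refine Halts.fetch hm (by norm_num) (by norm_num)
        (by simpa [Index.len, h15, State.reg_set] using hI.perfect.pos_lt _)
        (fin _ _ (by norm_num) (((Agree.refl _ _).set (by norm_num)).set (by norm_num)) ?_)
      simp [State.reg_set, Index.get, h15, hsl, hsc]
    · simp [Cond.holds, State.reg_set, Index.get, h15, q8, hsl] at hc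
      rw [if_neg (by omega)] at hsc
      refine Halts.fetch hm (by norm_num) (by norm_num)
        (by simpa [Index.len, h15, State.reg_set] using hI.perfect.pos_lt _)
        (fin _ _ (by norm_num) (((Agree.refl _ _).set (by norm_num)).set (by norm_num)) ?_)
      simp [State.reg_set, Index.get, h15, hsl, hsc]
  · have hzL : z = I.L := by
      by_contra hne
      exact hz' ⟨by have := hz.1; omega, .inr (by simpa using hin)⟩
    rw [if_neg hin] at h14
    refine Halts.ite (fun hc => ?_) (fun hc => ?_)
    · simp [Cond.holds, h14, q5] at hc
    · refine Halts.copy (fin _ _ (by norm_num) ((Agree.refl _ _).set (by norm_num)) ?_)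
      rw [hzL] at hin
      simp [State.reg_set, q4, sampleCount_eq_zero hI.keys hx hin]

/-- The bucket starts at the last sample not above `x`, and the sample `L` keys later, if any, is
above `x`. So the predecessor is fewer than `L < 2 ^ (h + 1)` keys away and a second bisection with
`h + 1` rounds finds it. -/
theorem halts_predecessor (hI : I.IsCorrect w) (hm : HasTables w mem I.len I.get 22)
    {s : State} {x : ℕ} (hx : x < 2 ^ I.L) (h4 : s.reg 4 = 0) (h5 : s.reg 5 = 1)
    (h8 : s.reg 8 = x) :
    Halts w mem predecessor (fun t s' => t ≤ 240 * (I.h + 1) ∧ Agree 9 s s' ∧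
      s'.reg 9 < I.m ∧ I.key (s'.reg 9) ≤ x ∧
      ∀ i, s'.reg 9 < i → i < I.m → x < I.key i) s := by
  set g := sampleCount I.key I.m I.L (x + 1) with hg
  obtain ⟨hgm, hgx⟩ := sampleCount_spec hI.keys (Nat.succ_pos x)
  rw [Nat.succ_eq_add_one, ← hg] at hgm hgx
  have hmw : I.m < 2 ^ w := hI.m_le.trans_lt ((Nat.pow_lt_pow_right (by norm_num)
    (Nat.lt_succ_self _)).trans_le (hI.pow_le (by omega)))
  let A : ℕ → Prop := fun z => g * I.L + z < I.m ∧ I.key (g * I.L + z) ≤ x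
  have hA : ∀ z z', z ≤ z' → A z' → A z := fun z z' hz ⟨h1, h2⟩ =>
    ⟨by omega, (hI.keys.le_of_le (by omega) h1).trans h2⟩
  have hAL : ¬ A I.L := by
    rintro ⟨h1, h2⟩
    rw [← Nat.succ_mul] at h1 h2
    have := le_key_of_sampleCount_lt hI.keys (y := x + 1) (Nat.lt_succ_self g) h1
    omega
  have hMw : I.m + 2 ^ (I.h + 1) < 2 ^ w := by
    have h1 := hI.step_le
    have h2 : I.L < 2 ^ I.L := Nat.lt_two_pow_self
    have h3 := hI.pow_le (k := I.L + 2) (by omega)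
    have h4 := hI.m_le
    rw [pow_succ, pow_succ] at h3
    rw [pow_succ]
    omega
  refine (halts_bucket (T := 7 + (I.h + 1) * 75) (Q := fun _ s' => Agree 9 s s' ∧
      s'.reg 9 < I.m ∧ I.key (s'.reg 9) ≤ x ∧ ∀ i, s'.reg 9 < i → i < I.m → x < I.key i)
      hI hm hx h4 h5 h8 ?_ (fun _ _ _ _ h => h)).mono ?_
  · intro s₁ hag h9
    rw [← hg] at h9
    have r4 : s₁.reg 4 = 0 := (hag.1 4 (by norm_num)).trans h4
    have r5 : s₁.reg 5 = 1 := (hag.1 5 (by norm_num)).trans h5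
    have r8 : s₁.reg 8 = x := (hag.1 8 (by norm_num)).trans h8
    refine Halts.seq ((halts_search (T := 70) (A := A) hI hm
      ⟨by simpa using hgm, by simpa using Nat.le_of_lt_succ hgx⟩
      (fun h => hAL (hA _ _ hI.lt_step.le h)) r4 r5 ?_).mono ?_)
    · intro s' hs h1 h2
      have e9 := (hs.1 9 (by norm_num)).trans h9
      have e8 := (hs.1 8 (by norm_num)).trans r8
      have := halts_bucketTest (w := w) hm (s := s') ((hs.1 4 (by norm_num)).trans r4)
        (by rw [e9]; omega) (Nat.one_lt_two_pow (by have := hI.le_word; omega))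
      rwa [e9, e8] at this
    · rintro t s' ⟨ht, hag', hz, hz'⟩
      have e9 : s'.reg 9 = g * I.L := (hag'.1 9 (by norm_num)).trans h9
      have hreg : (s'.set 9 (s'.reg 9 + s'.reg 10)).reg 9 = g * I.L + s'.reg 10 := by
        simp [State.reg_set, e9]
      refine Halts.add (by rw [e9]; have := hz.1; omega) ⟨by omega,
        (hag.trans (hag'.mono (by norm_num))).set (by norm_num), ?_⟩
      rw [hreg]
      refine ⟨hz.1, hz.2, fun i h1 h2 => ?_⟩
      by_contra! hle
      exact hz' ⟨by omega, (hI.keys.le_of_le (by omega) h2).trans hle⟩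
  · rintro t s' ⟨h1, h2⟩
    exact ⟨by omega, h2⟩

end WordRAM

/-! ### Processing one character -/

namespace RankedEdges

variable {E : Type*} {X : RankedEdges E} {n : ℕ} {Ep : Finset ℕ} {ident : ℕ → ℕ}

theorem IsWheeler.firstTgt_le (hX : X.IsWheeler n) (a i : ℕ) : X.firstTgt a i ≤ n := by
  by_cases h : ∃ e, X.lab e = a ∧ i ≤ X.src e
  · obtain ⟨e, ha, hi⟩ := h
    exact (RankedEdges.firstTgt_le ha hi).trans (hX.tgt_lt e).le
  · have : {t | ∃ e, X.lab e = a ∧ i ≤ X.src e ∧ X.tgt e = t} = ∅ := by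
      ext t
      simp only [Set.mem_ofPred_eq, Set.mem_empty_iff_false, iff_false]
      rintro ⟨e, h1, h2, -⟩
      exact h ⟨e, h1, h2⟩
    simp [firstTgt, this]

theorem IsWheeler.lastTgt_le [Fintype E] (hX : X.IsWheeler n) (a i : ℕ) : X.lastTgt a i ≤ n :=
  RankedEdges.lastTgt_le fun e _ _ => (hX.tgt_lt e).le

theorem IsWheeler.lastSrc_le [Fintype E] (hX : X.IsWheeler n) (a i : ℕ) : X.lastSrc a i ≤ n :=
  RankedEdges.lastSrc_le fun e _ _ => hX.src_lt e

end RankedEdges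

namespace WordRAM

/-- The structure `I` stores the successor function of the intervals of `X`. -/
structure Index.Represents {E : Type*} [Fintype E] (I : Index) (X : RankedEdges E)
    (Ep : Finset ℕ) (ident : ℕ → ℕ) (σ : ℕ) : Prop where
  isWheeler : X.IsWheeler I.n
  isPathLike : X.IsPathLike Ep ident
  id₀_eq : I.id₀ = ident (I.n - 1)
  exists_key : ∀ a j, j < I.n → X.IsKey Ep a j → ∃ i < I.m, I.key i = a * I.n + j
  n_le : I.n ≤ 2 ^ I.L
  mul_le : σ * I.n ≤ 2 ^ I.L
  mode_eq_zero : ∀ i < I.m, I.mode i = 0 ↔ ¬ X.Good Ep (I.key i / I.n) (I.key i % I.n)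
  lastSrc_eq : ∀ i < I.m, I.lastSrc i = X.lastSrc (I.key i / I.n) (I.key i % I.n)
  lastTgt_eq : ∀ i < I.m, I.lastTgt i = X.lastTgt (I.key i / I.n) (I.key i % I.n)
  lastId_eq : ∀ i < I.m, I.lastId i = ident (X.lastTgt (I.key i / I.n) (I.key i % I.n))
  first_eq : ∀ i < I.m, I.first i = X.firstTgt (I.key i / I.n) (I.key i % I.n)
  next_eq : ∀ i < I.m, I.next i = X.firstTgt (I.key i / I.n) (I.key i % I.n + 1)

namespace Index.Represents

variable {E : Type*} [Fintype E] {I : Index} {X : RankedEdges E} {Ep : Finset ℕ}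
  {ident : ℕ → ℕ} {σ : ℕ}

/-- The last breakpoint up to `(a, j)`, when it belongs to the character `a`. -/
theorem div_mod (hR : I.Represents X Ep ident σ) {a j k : ℕ} (hj : j < I.n)
    (hk : I.key k ≤ a * I.n + j) (ha : a * I.n ≤ I.key k)
    (hlast : ∀ i, k < i → i < I.m → a * I.n + j < I.key i)
    (hmono : ∀ i i', i ≤ i' → i' < I.m → I.key i ≤ I.key i') (hkm : k < I.m) :
    I.key k / I.n = a ∧ I.key k % I.n = I.key k - a * I.n ∧ I.key k - a * I.n ≤ j ∧
      ∀ j', I.key k - a * I.n < j' → j' ≤ j → ¬ X.IsKey Ep a j' := by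
  obtain ⟨j₀, hj₀⟩ := Nat.exists_eq_add_of_le ha
  have hj₀n : j₀ < I.n := by omega
  have h1 : I.key k / I.n = a := by
    rw [hj₀, Nat.mul_comm, Nat.mul_add_div (by omega), Nat.div_eq_of_lt hj₀n, Nat.add_zero]
  have h2 : I.key k % I.n = j₀ := by
    rw [hj₀, Nat.mul_comm, Nat.mul_add_mod, Nat.mod_eq_of_lt hj₀n]
  refine ⟨h1, by omega, by omega, fun j' h3 h4 h5 => ?_⟩
  obtain ⟨i, hi, hij⟩ := hR.exists_key a j' (by omega) h5
  by_cases hki : k < i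
  · have := hlast i hki hi
    omega
  · have := hmono i k (by omega) hkm
    omega

/-- Position 0 of every occurring character is a breakpoint, so a predecessor that belongs to a
smaller character shows that `a` labels no edge. -/
theorem lastSrc_eq_zero (hR : I.Represents X Ep ident σ) {a j k : ℕ} (hj : j < I.n)
    (ha : I.key k < a * I.n) (hlast : ∀ i, k < i → i < I.m → a * I.n + j < I.key i)
    (hmono : ∀ i i', i ≤ i' → i' < I.m → I.key i ≤ I.key i') (hkm : k < I.m) (j' : ℕ) :
    X.lastSrc a j' = 0 := by
  refine Nat.le_zero.1 (RankedEdges.lastSrc_le fun e he _ => ?_)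
  exfalso
  obtain ⟨i, hi, hij⟩ := hR.exists_key a 0 (by omega) ⟨e, he, .inl rfl⟩
  by_cases hki : k < i
  · have := hlast i hki hi
    omega
  · have := hmono i k (by omega) hkm
    omega

end Index.Represents

/-- The first end of the next interval, for the breakpoint number `reg 9` of the query `reg 8`. -/
def nextFirst : Cmd :=
  .seq (fetch 16 15 9) <| .seq (.instr (.op 16 .sub 8 16)) <|
  .ite (.eq 16 4) (fetch 7 20 9) <| .seq (fetch 17 16 9) <|
    .ite (.eq 17 4) (fetch 7 21 9) <| .seq (fetch 7 20 9) (.instr (.op 7 .add 7 16))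

/-- The last source, the last end of the next interval and the identifier of the latter, for the
breakpoint number `reg 9` of the query `reg 8`. -/
def nextLast : Cmd :=
  .seq (fetch 16 15 9) <| .seq (.instr (.op 16 .sub 8 16)) <| .seq (fetch 17 16 9) <|
  .ite (.eq 17 4) (.seq (fetch 18 17 9) <| .seq (fetch 19 18 9) (fetch 20 19 9)) <|
    .seq (.instr (.op 18 .add 2 5)) <| .seq (fetch 19 18 9) <|
      .seq (.instr (.op 19 .add 19 16)) (.instr (.op 20 .add 3 5))

/-- Replace the interval from `reg 1` to `reg 2`, with identifier `reg 3` of its last vertex, by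
the interval of the vertices that are reached from it by edges labelled `reg 6`. -/
def step : Cmd :=
  .seq (fetch 7 0 4) <| .seq (.instr (.op 6 .mul 6 7)) <| .seq (.instr (.op 8 .add 6 1)) <|
  .seq predecessor <| .seq (fetch 16 15 9) <| .ite (.lt 16 6) (.instr (.copy 0 4)) <|
  .seq nextFirst <| .seq (.instr (.op 8 .add 6 2)) <| .seq predecessor <| .seq nextLast <|
  .ite (.lt 1 18) (.seq (.instr (.copy 1 7)) <| .seq (.instr (.copy 2 19)) (.instr (.copy 3 20)))
    (.instr (.copy 0 4))

/-- The query program. -/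
def toehold : Cmd :=
  .seq (.instr (.const 5 1)) <| .seq (fetch 2 0 4) <| .seq (fetch 3 1 4) <|
  .seq (.ite (.lt 4 2) (.seq (.instr (.copy 0 5)) (.instr (.op 2 .sub 2 5))) (.instr .nop)) <|
  .loop .more <| .seq (.instr (.read 6)) (.ite (.eq 0 5) step (.instr .nop))

variable {E : Type*} [Fintype E] {I : Index} {X : RankedEdges E} {Ep : Finset ℕ}
  {ident : ℕ → ℕ} {σ w : ℕ} {mem : List ℕ}

/-- At the breakpoint itself `first` is the answer. Beyond it, a good stretch shifts `first` by the
distance, and any other stretch uses `next`, which ignores the edges leaving the breakpoint. -/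
theorem halts_nextFirst (hI : I.IsCorrect w) (hm : HasTables w mem I.len I.get 22)
    (hR : I.Represents X Ep ident σ) {s : State} {a i k : ℕ} (hi : i < I.n)
    (hai : a * I.n + i < 2 ^ I.L) (hkm : k < I.m) (hk : I.key k ≤ a * I.n + i)
    (hak : a * I.n ≤ I.key k) (hlast : ∀ i', k < i' → i' < I.m → a * I.n + i < I.key i')
    (h4 : s.reg 4 = 0) (h8 : s.reg 8 = a * I.n + i) (h9 : s.reg 9 = k) :
    Halts w mem nextFirst (fun t s' => t ≤ 20 ∧ Agree 7 s s' ∧ s'.reg 7 = X.firstTgt a i) s := by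
  have hX := hR.isWheeler
  have hP := hR.isPathLike
  have hLw : 2 ^ I.L * 2 < 2 ^ w := by
    rw [← pow_succ]
    exact (Nat.pow_lt_pow_right (by norm_num) (Nat.lt_succ_self _)).trans_le
      (hI.pow_le (by omega))
  have hn := hR.n_le
  obtain ⟨hdiv, hmod, hle, hnokey⟩ := hR.div_mod hi hk hak hlast
    (fun i i' h h' => hI.keys.le_of_le h h') hkm
  have hfirst := hR.first_eq k hkm
  have hnext := hR.next_eq k hkm
  have hmode := hR.mode_eq_zero k hkm
  rw [hdiv, hmod] at hfirst hnext hmode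
  set j₀ := I.key k - a * I.n with hj₀
  refine Halts.seq (Halts.fetch hm (by norm_num) (by norm_num)
    (by simpa [Index.len, h9] using hkm) ?_)
  refine Halts.seq (Halts.sub (by simp [State.reg_set, Index.get, h8, h9]; omega)
    (by simp [State.reg_set, h8]; omega) ?_)
  have hd : a * I.n + i - I.key k = i - j₀ := by omega
  simp only [State.reg_set, Index.get, Nat.reduceEqDiff, reduceIte, h8, h9, hd, State.set_set]
  refine Halts.ite (fun hc => ?_) (fun hc => ?_)
  · simp [Cond.holds, State.reg_set, h4] at hc
    refine Halts.fetch hm (by norm_num) (by norm_num)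
      (by simpa [Index.len, State.reg_set, h9] using hkm) ⟨by norm_num, ?_, ?_⟩
    · exact ((Agree.refl _ _).set (by norm_num)).set (by norm_num)
    · simp [State.reg_set, Index.get, h9, hfirst]
      rw [show i = j₀ by omega]
  · simp [Cond.holds, State.reg_set, h4] at hc
    refine Halts.seq (Halts.fetch hm (by norm_num) (by norm_num)
      (by simpa [Index.len, State.reg_set, h9] using hkm) ?_)
    refine Halts.ite (fun hc' => ?_) (fun hc' => ?_)
    · simp [Cond.holds, State.reg_set, Index.get, h9, h4] at hc'
      refine Halts.fetch hm (by norm_num) (by norm_num)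
        (by simpa [Index.len, State.reg_set, h9] using hkm) ⟨by norm_num, ?_, ?_⟩
      · exact (((Agree.refl _ _).set (by norm_num)).set (by norm_num)).set (by norm_num)
      · simp [State.reg_set, Index.get, h9, hnext]
        exact ((RankedEdges.record_of_not_good hP (hmode.1 hc') hle hnokey).2.2
          (by omega)).symm
    · simp [Cond.holds, State.reg_set, Index.get, h9, h4] at hc'
      have hg := (not_iff_comm.1 hmode.symm).1 hc'
      have hrec := hg.record hX hP hle hi hnokey
      have hf := hX.firstTgt_le a i
      refine Halts.seq (Halts.fetch hm (by norm_num) (by norm_num)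
        (by simpa [Index.len, State.reg_set, h9] using hkm) ?_)
      refine Halts.add ?_ ⟨by norm_num, ?_, ?_⟩
      · simp [State.reg_set, Index.get, h9, hfirst]
        rw [← hrec.2.2.1]
        omega
      · exact ((((Agree.refl _ _).set (by norm_num)).set (by norm_num)).set
          (by norm_num)).set (by norm_num)
      · simp [State.reg_set, Index.get, h9, hfirst]
        exact hrec.2.2.1.symm

/-- The identifier is stored only for stretches where the last target is constant; on a good stretch
it is the current identifier plus 1. -/
theorem halts_nextLast (hI : I.IsCorrect w) (hm : HasTables w mem I.len I.get 22)
    (hR : I.Represents X Ep ident σ) {s : State} {a j k : ℕ} (hj : j < I.n)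
    (haj : a * I.n + j < 2 ^ I.L) (hkm : k < I.m) (hk : I.key k ≤ a * I.n + j)
    (hak : a * I.n ≤ I.key k) (hlast : ∀ i', k < i' → i' < I.m → a * I.n + j < I.key i')
    (hid : ident j ≤ I.n) (h2 : s.reg 2 = j) (h3 : s.reg 3 = ident j)
    (h4 : s.reg 4 = 0) (h5 : s.reg 5 = 1) (h8 : s.reg 8 = a * I.n + j) (h9 : s.reg 9 = k) :
    Halts w mem nextLast (fun t s' => t ≤ 30 ∧ Agree 8 s s' ∧ s'.reg 18 = X.lastSrc a j ∧
      s'.reg 19 = X.lastTgt a j ∧ s'.reg 20 = ident (X.lastTgt a j)) s := by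
  have hX := hR.isWheeler
  have hP := hR.isPathLike
  have hLw : 2 ^ I.L * 2 < 2 ^ w := by
    rw [← pow_succ]
    exact (Nat.pow_lt_pow_right (by norm_num) (Nat.lt_succ_self _)).trans_le
      (hI.pow_le (by omega))
  have hL1 := Nat.one_le_two_pow (n := I.L)
  have hn := hR.n_le
  obtain ⟨hdiv, hmod, hle, hnokey⟩ := hR.div_mod hj hk hak hlast
    (fun i i' h h' => hI.keys.le_of_le h h') hkm
  have hsrc := hR.lastSrc_eq k hkm
  have htgt := hR.lastTgt_eq k hkm
  have hlid := hR.lastId_eq k hkm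
  have hmode := hR.mode_eq_zero k hkm
  rw [hdiv, hmod] at hsrc htgt hlid hmode
  set j₀ := I.key k - a * I.n with hj₀
  refine Halts.seq (Halts.fetch hm (by norm_num) (by norm_num)
    (by simpa [Index.len, h9] using hkm) ?_)
  refine Halts.seq (Halts.sub (by simp [State.reg_set, Index.get, h8, h9]; omega)
    (by simp [State.reg_set, h8]; omega) ?_)
  have hd : a * I.n + j - I.key k = j - j₀ := by omega
  simp only [State.reg_set, Index.get, Nat.reduceEqDiff, reduceIte, h8, h9, hd, State.set_set]
  refine Halts.seq (Halts.fetch hm (by norm_num) (by norm_num)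
    (by simpa [Index.len, State.reg_set, h9] using hkm) ?_)
  simp only [State.reg_set, Index.get, Nat.reduceEqDiff, reduceIte, h9]
  refine Halts.ite (fun hc => ?_) (fun hc => ?_)
  · simp [Cond.holds, State.reg_set, h4] at hc
    have hrec := RankedEdges.record_of_not_good hP (hmode.1 hc) hle hnokey
    refine Halts.seq (Halts.fetch hm (by norm_num) (by norm_num)
      (by simpa [Index.len, State.reg_set, h9] using hkm) ?_)
    refine Halts.seq (Halts.fetch hm (by norm_num) (by norm_num)
      (by simpa [Index.len, State.reg_set, h9] using hkm) ?_)
    refine Halts.fetch hm (by norm_num) (by norm_num)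
      (by simpa [Index.len, State.reg_set, h9] using hkm) ⟨by norm_num, ?_, ?_, ?_, ?_⟩
    · repeat' first | exact Agree.refl _ _ | refine Agree.set ?_ (by norm_num)
    · simp [State.reg_set, Index.get, h9, hsrc, hrec.1]
    · simp [State.reg_set, Index.get, h9, htgt, hrec.2.1]
    · simp [State.reg_set, Index.get, h9, hlid, hrec.2.1]
  · simp [Cond.holds, State.reg_set, h4] at hc
    have hg := (not_iff_comm.1 hmode.symm).1 hc
    have hrec := hg.record hX hP hle hj hnokey
    have hf := hX.lastTgt_le a j
    refine Halts.seq (Halts.add (by simp [State.reg_set, h2, h5]; omega) ?_)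
    refine Halts.seq (Halts.fetch hm (by norm_num) (by norm_num)
      (by simpa [Index.len, State.reg_set, h9] using hkm) ?_)
    refine Halts.seq (Halts.add ?_ ?_)
    · simp [State.reg_set, Index.get, h9, htgt]
      rw [← hrec.2.1]
      omega
    refine Halts.add ?_ ⟨by norm_num, ?_, ?_, ?_, ?_⟩
    · simp [State.reg_set, h3, h5]
      omega
    · repeat' first | exact Agree.refl _ _ | refine Agree.set ?_ (by norm_num)
    · simp [State.reg_set, h2, h5, hrec.1]
    · simp [State.reg_set, Index.get, h9, htgt]
      exact hrec.2.1.symm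
    · simp [State.reg_set, h3, h5, hrec.2.2.2]

/-- The left end depends on `(a, i)` alone, and the right end, its identifier and the test for
emptiness use data at `(a, j)`, so two predecessor searches suffice. -/
theorem halts_step (hI : I.IsCorrect w) (hm : HasTables w mem I.len I.get 22)
    (hR : I.Represents X Ep ident σ) {s : State} {a i j : ℕ} (ha : a < σ) (hij : i ≤ j)
    (hj : j < I.n) (hid : ident j ≤ I.n) (h0 : s.reg 0 = 1) (h1 : s.reg 1 = i)
    (h2 : s.reg 2 = j) (h3 : s.reg 3 = ident j) (h4 : s.reg 4 = 0) (h5 : s.reg 5 = 1)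
    (h6 : s.reg 6 = a) :
    Halts w mem step (fun t s' => t ≤ 600 * (I.h + 1) ∧ s'.input = s.input ∧ s'.reg 4 = 0 ∧
      s'.reg 5 = 1 ∧ ((s'.reg 0 = 0 ∧ ¬ i < X.lastSrc a j) ∨
        (s'.reg 0 = 1 ∧ i < X.lastSrc a j ∧ s'.reg 1 = X.firstTgt a i ∧
          s'.reg 2 = X.lastTgt a j ∧ s'.reg 3 = ident (X.lastTgt a j)))) s := by
  have hmono : ∀ i i', i ≤ i' → i' < I.m → I.key i ≤ I.key i' :=
    fun i i' h h' => hI.keys.le_of_le h h'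
  have hLw : 2 ^ I.L < 2 ^ w := (Nat.pow_lt_pow_right (by norm_num) (Nat.lt_succ_self _)).trans_le
    (hI.pow_le (by omega))
  have haj : a * I.n + j < 2 ^ I.L := by
    have h1 := Nat.mul_le_mul_right I.n (Nat.succ_le_of_lt ha)
    have h2 := hR.mul_le
    rw [Nat.succ_mul] at h1
    omega
  refine Halts.seq (Halts.fetch hm (by norm_num) (by norm_num)
    (by simp [Index.len, h4]) ?_)
  refine Halts.seq (Halts.mul (by simp [State.reg_set, Index.get, h6]; omega) ?_)
  refine Halts.seq (Halts.add (by simp [State.reg_set, Index.get, h6, h1]; omega) ?_)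
  simp only [State.reg_set, Index.get, Nat.reduceEqDiff, reduceIte, h6, h1]
  refine Halts.seq ((halts_predecessor (x := a * I.n + i) hI hm (by omega)
    (by simp [State.reg_set, h4]) (by simp [State.reg_set, h5])
    (by simp [State.reg_set])).mono ?_)
  rintro t₁ s₁ ⟨ht₁, hag₁, hk₁m, hk₁, hlast₁⟩
  have a0 : s₁.reg 0 = 1 := by simp [hag₁.1 0 (by norm_num), State.reg_set, h0]
  have a1 : s₁.reg 1 = i := by simp [hag₁.1 1 (by norm_num), State.reg_set, h1]
  have a2 : s₁.reg 2 = j := by simp [hag₁.1 2 (by norm_num), State.reg_set, h2]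
  have a3 : s₁.reg 3 = ident j := by simp [hag₁.1 3 (by norm_num), State.reg_set, h3]
  have a4 : s₁.reg 4 = 0 := by simp [hag₁.1 4 (by norm_num), State.reg_set, h4]
  have a5 : s₁.reg 5 = 1 := by simp [hag₁.1 5 (by norm_num), State.reg_set, h5]
  have a6 : s₁.reg 6 = a * I.n := by simp [hag₁.1 6 (by norm_num), State.reg_set]
  have a8 : s₁.reg 8 = a * I.n + i := by simp [hag₁.1 8 (by norm_num), State.reg_set]
  have ain : s₁.input = s.input := by simp [hag₁.2]
  clear hag₁
  refine Halts.seq (Halts.fetch hm (by norm_num) (by norm_num)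
    (by simpa [Index.len] using hk₁m) ?_)
  refine Halts.ite (fun hc => ?_) (fun hc => ?_)
  · simp [Cond.holds, State.reg_set, Index.get, a6] at hc
    refine Halts.copy ⟨by omega, by simp [ain], by simp [State.reg_set, a4],
      by simp [State.reg_set, a5], .inl ⟨by simp [State.reg_set, a4], ?_⟩⟩
    rw [hR.lastSrc_eq_zero (by omega) hc hlast₁ hmono hk₁m]
    omega
  simp [Cond.holds, State.reg_set, Index.get, a6] at hc
  refine Halts.seq ((halts_nextFirst (a := a) (i := i) hI hm hR (by omega) (by omega) hk₁m hk₁ hc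
    hlast₁ (by simp [State.reg_set, a4]) (by simp [State.reg_set, a8])
    (by simp [State.reg_set])).mono ?_)
  rintro t₂ s₂ ⟨ht₂, hag₂, b7⟩
  have b0 : s₂.reg 0 = 1 := by simp [hag₂.1 0 (by norm_num), State.reg_set, a0]
  have b1 : s₂.reg 1 = i := by simp [hag₂.1 1 (by norm_num), State.reg_set, a1]
  have b2 : s₂.reg 2 = j := by simp [hag₂.1 2 (by norm_num), State.reg_set, a2]
  have b3 : s₂.reg 3 = ident j := by simp [hag₂.1 3 (by norm_num), State.reg_set, a3]
  have b4 : s₂.reg 4 = 0 := by simp [hag₂.1 4 (by norm_num), State.reg_set, a4]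
  have b5 : s₂.reg 5 = 1 := by simp [hag₂.1 5 (by norm_num), State.reg_set, a5]
  have b6 : s₂.reg 6 = a * I.n := by simp [hag₂.1 6 (by norm_num), State.reg_set, a6]
  have bin : s₂.input = s.input := by simp [hag₂.2, ain]
  clear hag₂
  refine Halts.seq (Halts.add (by rw [b6, b2]; omega) ?_)
  rw [b6, b2]
  refine Halts.seq ((halts_predecessor (x := a * I.n + j) hI hm haj
    (by simp [State.reg_set, b4]) (by simp [State.reg_set, b5])
    (by simp [State.reg_set])).mono ?_)
  rintro t₃ s₃ ⟨ht₃, hag₃, hk₃m, hk₃, hlast₃⟩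
  have c0 : s₃.reg 0 = 1 := by simp [hag₃.1 0 (by norm_num), State.reg_set, b0]
  have c1 : s₃.reg 1 = i := by simp [hag₃.1 1 (by norm_num), State.reg_set, b1]
  have c2 : s₃.reg 2 = j := by simp [hag₃.1 2 (by norm_num), State.reg_set, b2]
  have c3 : s₃.reg 3 = ident j := by simp [hag₃.1 3 (by norm_num), State.reg_set, b3]
  have c4 : s₃.reg 4 = 0 := by simp [hag₃.1 4 (by norm_num), State.reg_set, b4]
  have c5 : s₃.reg 5 = 1 := by simp [hag₃.1 5 (by norm_num), State.reg_set, b5]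
  have c7 : s₃.reg 7 = X.firstTgt a i := by simp [hag₃.1 7 (by norm_num), State.reg_set, b7]
  have c8 : s₃.reg 8 = a * I.n + j := by simp [hag₃.1 8 (by norm_num), State.reg_set]
  have cin : s₃.input = s.input := by simp [hag₃.2, bin]
  clear hag₃
  -- Since `i ≤ j`, the second predecessor is not below the first, so it belongs to the character
  -- `a` too.
  have hkl : I.key (s₁.reg 9) ≤ I.key (s₃.reg 9) := by
    by_contra! hlt
    have hlk : s₃.reg 9 < s₁.reg 9 := by
      by_contra! h
      have := hmono _ _ h hk₃m
      omega
    have := hlast₃ _ hlk hk₁m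
    omega
  refine Halts.seq ((halts_nextLast hI hm hR hj haj hk₃m hk₃ (hc.trans hkl) hlast₃ hid c2 c3 c4
    c5 c8 rfl).mono ?_)
  rintro t₄ s₄ ⟨ht₄, hag₄, e18, e19, e20⟩
  have d0 : s₄.reg 0 = 1 := (hag₄.1 0 (by norm_num)).trans c0
  have d1 : s₄.reg 1 = i := (hag₄.1 1 (by norm_num)).trans c1
  have d4 : s₄.reg 4 = 0 := (hag₄.1 4 (by norm_num)).trans c4
  have d5 : s₄.reg 5 = 1 := (hag₄.1 5 (by norm_num)).trans c5
  have d7 : s₄.reg 7 = X.firstTgt a i := (hag₄.1 7 (by norm_num)).trans c7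
  have din : s₄.input = s.input := hag₄.2.trans cin
  clear hag₄
  refine Halts.ite (fun hc => ?_) (fun hc => ?_)
  · simp only [Cond.holds, d1, e18] at hc
    refine Halts.seq (Halts.copy (Halts.seq (Halts.copy (Halts.copy ⟨by omega, ?_⟩))))
    simp [State.reg_set, d0, d4, d5, d7, e19, e20, din, hc]
  · simp only [Cond.holds, d1, e18] at hc
    refine Halts.copy ⟨by omega, ?_⟩
    simp [State.reg_set, d4, d5, din]
    omega

end WordRAM

/-! ### The whole query, and the construction of the index -/

namespace WordRAM

section

variable {V E : Type*} [Fintype E] {σ n w : ℕ} {G : LabelledGraph V E σ} {rank ident : V ≃ Fin n}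
  {Ep : Finset ℕ} {I : Index} {mem : List ℕ}

theorem isToeholdAnswer_of_not_lt {P : List (Fin σ)} {a : Fin σ} {reg reg' : ℕ → ℕ} (h0 : reg 0 = 1)
    (h : IsToeholdAnswer G rank ident P reg) (h0' : reg' 0 = 0)
    (hlt : ¬ reg 1 < (G.ranked rank).lastSrc a (reg 2)) :
    IsToeholdAnswer G rank ident (P ++ [a]) reg' := by
  rcases h with ⟨h, -⟩ | ⟨-, -, -, hreach, -⟩
  · omega
  refine .inl ⟨h0', fun v hv => ?_⟩
  obtain ⟨e, rfl, he, -⟩ := LabelledGraph.reached_append_singleton.1 hv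
  exact RankedEdges.not_exists_edge (X := G.ranked rank) hlt e rfl ((hreach _).1 he)

theorem isToeholdAnswer_of_lt (hX : (G.ranked rank).IsWheeler n) {P : List (Fin σ)} {a : Fin σ}
    {reg reg' : ℕ → ℕ} (h0 : reg 0 = 1) (h : IsToeholdAnswer G rank ident P reg)
    (h0' : reg' 0 = 1) (hlt : reg 1 < (G.ranked rank).lastSrc a (reg 2))
    (h1' : reg' 1 = (G.ranked rank).firstTgt a (reg 1))
    (h2' : reg' 2 = (G.ranked rank).lastTgt a (reg 2))
    (h3' : reg' 3 = LabelledGraph.identOfRank rank ident (reg' 2)) :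
    IsToeholdAnswer G rank ident (P ++ [a]) reg' := by
  rcases h with ⟨h, -⟩ | ⟨-, -, -, hreach, -⟩
  · omega
  have hiff := hX.exists_edge_iff hlt
  obtain ⟨e, ha, hi, hj⟩ := RankedEdges.exists_of_lt_lastSrc hlt
  have h12 := (hiff _).1 ⟨e, ha, ⟨hi, hj⟩, rfl⟩
  rw [← h1', ← h2'] at h12
  refine .inr ⟨h0', by omega, ?_, fun v => ?_, fun v hv => ?_⟩
  · rw [h2']
    obtain ⟨e', -, -, ht⟩ := (hiff _).2 ⟨by omega, le_rfl⟩
    rw [← ht]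
    exact hX.tgt_lt e'
  · rw [LabelledGraph.reached_append_singleton, h1', h2', ← hiff]
    constructor
    · rintro ⟨e, rfl, he, rfl⟩
      exact ⟨e, rfl, (hreach _).1 he, rfl⟩
    · rintro ⟨e, he, h, ht⟩
      exact ⟨e, Fin.ext he, (hreach _).2 h, rank.injective (Fin.ext ht)⟩
  · rw [h3', ← hv, LabelledGraph.identOfRank_rank]

theorem halts_toehold_loop (hI : I.IsCorrect w) (hm : HasTables w mem I.len I.get 22)
    (hR : I.Represents (G.ranked rank) Ep (LabelledGraph.identOfRank rank ident) σ)
    (hn : I.n = n) (hσ : σ < 2 ^ w) (R : List (Fin σ)) :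
    ∀ (P : List (Fin σ)) (s : State), s.input = R.map (fun a : Fin σ => a.val) →
      s.reg 4 = 0 → s.reg 5 = 1 → IsToeholdAnswer G rank ident P s.reg →
      Halts w mem (.loop .more <| .seq (.instr (.read 6)) (.ite (.eq 0 5) step (.instr .nop)))
        (fun t s' => t ≤ 1 + R.length * (610 * (I.h + 1)) ∧
          IsToeholdAnswer G rank ident (P ++ R) s'.reg) s := by
  induction R with
  | nil =>
    intro P s hin h4 h5 hP
    exact Halts.loop_done (by simp [Cond.holds, hin]) ⟨by omega, by simpa using hP⟩
  | cons a R ih =>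
    intro P s hin h4 h5 hP
    refine Halts.loop_step (by simp [Cond.holds, hin]) (Halts.seq (Halts.instr ?_))
    set s₁ := Instr.step w mem s (.read 6) with hs₁
    have hreg : ∀ r, s₁.reg r = if r = 6 then a.val else s.reg r := by
      intro r
      simp [hs₁, Instr.step, hin, Function.update_apply, Nat.mod_eq_of_lt (a.isLt.trans hσ)]
    have hin₁ : s₁.input = R.map (fun a : Fin σ => a.val) := by simp [hs₁, Instr.step, hin]
    clear_value s₁
    have hlen : (a :: R).length * (610 * (I.h + 1)) =
        R.length * (610 * (I.h + 1)) + 610 * (I.h + 1) := by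
      rw [List.length_cons, Nat.succ_mul]
    have cont : ∀ t₂ s₂, t₂ ≤ 1 + 600 * (I.h + 1) → s₂.input = R.map (fun a : Fin σ => a.val) →
        s₂.reg 4 = 0 → s₂.reg 5 = 1 → IsToeholdAnswer G rank ident (P ++ [a]) s₂.reg →
        Halts w mem (.loop .more <| .seq (.instr (.read 6)) (.ite (.eq 0 5) step (.instr .nop)))
          (fun t s' => 1 + (1 + (1 + t₂)) + t ≤ 1 + (a :: R).length * (610 * (I.h + 1)) ∧
            IsToeholdAnswer G rank ident (P ++ a :: R) s'.reg) s₂ := by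
      intro t₂ s₂ ht₂ e1 e4 e5 hA
      refine (ih _ s₂ e1 e4 e5 hA).mono ?_
      rintro t s' ⟨ht, h⟩
      exact ⟨by omega, by simpa using h⟩
    have g0 : s₁.reg 0 = s.reg 0 := by simp [hreg]
    have g1 : s₁.reg 1 = s.reg 1 := by simp [hreg]
    have g2 : s₁.reg 2 = s.reg 2 := by simp [hreg]
    have g3 : s₁.reg 3 = s.reg 3 := by simp [hreg]
    have g4 : s₁.reg 4 = 0 := by simp [hreg, h4]
    have g5 : s₁.reg 5 = 1 := by simp [hreg, h5]
    have g6 : s₁.reg 6 = a := by simp [hreg]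
    refine Halts.ite (fun hc => ?_) (fun hc => ?_)
    · simp only [Cond.holds, g0, g5] at hc
      have hP' := hP
      rcases hP' with ⟨h, -⟩ | ⟨-, hij, hjn, -, hid⟩
      · omega
      have hidj : LabelledGraph.identOfRank rank ident (s.reg 2) = s.reg 3 := by
        have := hid (rank.symm ⟨s.reg 2, hjn⟩) (by simp)
        rw [this, LabelledGraph.identOfRank, dif_pos hjn]
      refine (halts_step (a := (a : ℕ)) hI hm hR a.isLt hij (by rw [hn]; exact hjn)
        (by rw [hn]; exact LabelledGraph.identOfRank_le _ _ _) (by rw [g0, hc]) g1 g2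
        (by rw [g3, hidj]) g4 g5 g6).mono ?_
      rintro t s₂ ⟨ht, e1, e4, e5, ⟨e0, hlt⟩ | ⟨e0, hlt, f1, f2, f3⟩⟩
      · exact cont _ _ (ht.trans (Nat.le_add_left _ _)) (e1.trans hin₁) e4 e5
          (isToeholdAnswer_of_not_lt hc hP e0 hlt)
      · exact cont _ _ (ht.trans (Nat.le_add_left _ _)) (e1.trans hin₁) e4 e5
          (isToeholdAnswer_of_lt (hn ▸ hR.isWheeler) hc hP e0 hlt f1 f2 (by rw [f3, f2]))
    · simp only [Cond.holds, g0, g5] at hc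
      refine Halts.instr (cont _ _ (by omega) hin₁ g4 g5 ?_)
      -- After a failure the remaining input is only consumed: a pattern without walks has no
      -- extension with one.
      rcases hP with ⟨h, hno⟩ | ⟨h, -⟩
      · refine .inl ⟨g0.trans h, fun v hv => ?_⟩
        obtain ⟨e, -, he, -⟩ := LabelledGraph.reached_append_singleton.1 hv
        exact hno _ he
      · exact absurd h hc

/-- The empty pattern reaches every vertex, so the start is the full range of ranks with the stored
identifier of its last vertex. With no vertices, `reg 0` stays 0. -/
theorem halts_toehold (hI : I.IsCorrect w) (hm : HasTables w mem I.len I.get 22)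
    (hR : I.Represents (G.ranked rank) Ep (LabelledGraph.identOfRank rank ident) σ)
    (hn : I.n = n) (hσ : σ < 2 ^ w) (P : List (Fin σ)) :
    Halts w mem toehold (fun t s' => t ≤ 30 + P.length * (610 * (I.h + 1)) ∧
      IsToeholdAnswer G rank ident P s'.reg)
      (State.start (P.map (fun a : Fin σ => a.val))) := by
  have h1w : 1 < 2 ^ w := Nat.one_lt_two_pow (by have := hI.le_word; omega)
  have hnw : I.n < 2 ^ w := hR.n_le.trans_lt ((Nat.pow_lt_pow_right (by norm_num)
    (Nat.lt_succ_self _)).trans_le (hI.pow_le (by omega)))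
  refine Halts.seq (Halts.const h1w ?_)
  refine Halts.seq (Halts.fetch hm (by norm_num) (by norm_num)
    (by simp [Index.len, State.reg_set, State.start]) ?_)
  refine Halts.seq (Halts.fetch hm (by norm_num) (by norm_num)
    (by simp [Index.len, State.reg_set, State.start]) ?_)
  have cont : ∀ t₂ s₂, t₂ ≤ 10 → s₂.input = P.map (fun a : Fin σ => a.val) →
      s₂.reg 4 = 0 → s₂.reg 5 = 1 → IsToeholdAnswer G rank ident [] s₂.reg →
      Halts w mem (.loop .more <| .seq (.instr (.read 6)) (.ite (.eq 0 5) step (.instr .nop)))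
        (fun t s' => 1 + (4 + (4 + (t₂ + t))) ≤ 30 + P.length * (610 * (I.h + 1)) ∧
          IsToeholdAnswer G rank ident P s'.reg) s₂ := by
    intro t₂ s₂ ht₂ e1 e4 e5 hA
    refine (halts_toehold_loop hI hm hR hn hσ P [] s₂ e1 e4 e5 hA).mono ?_
    rintro t s' ⟨ht, h⟩
    exact ⟨by omega, by simpa using h⟩
  refine Halts.seq (Halts.ite (fun hc => ?_) (fun hc => ?_))
  · simp [Cond.holds, State.reg_set, State.start, Index.get] at hc
    refine Halts.seq (Halts.copy (Halts.sub ?_ ?_ ?_))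
    · simp [State.reg_set, State.start, Index.get]; omega
    · simp [State.reg_set, State.start, Index.get]; omega
    refine cont _ _ (by norm_num) (by simp [State.start]) (by simp [State.reg_set, State.start])
      (by simp [State.reg_set, State.start]) (.inr ⟨?_, ?_, ?_, fun v => ?_, fun v hv => ?_⟩)
    · simp [State.reg_set, State.start]
    · simp [State.reg_set, State.start]
    · simp [State.reg_set, State.start, Index.get]; omega
    · simp only [State.reg_set, State.start, Index.get, Nat.reduceEqDiff, reduceIte]
      refine iff_of_true ⟨v, .nil v⟩ ⟨by norm_num, ?_⟩
      have := (rank v).isLt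
      simp; omega
    · simp [State.reg_set, State.start, Index.get] at hv ⊢
      rw [hR.id₀_eq, ← hv, LabelledGraph.identOfRank_rank]
  · simp [Cond.holds, State.reg_set, State.start, Index.get] at hc
    refine Halts.instr (cont _ _ (by norm_num) (by simp [State.start, Instr.step])
      (by simp [State.reg_set, State.start, Instr.step])
      (by simp [State.reg_set, State.start, Instr.step]) (.inl ⟨?_, fun v => ?_⟩))
    · simp [State.reg_set, State.start, Instr.step]
    · have := (rank v).isLt
      omega

/-- The structure for given breakpoints. -/
theorem exists_index {L : ℕ} (hX : (G.ranked rank).IsWheeler n)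
    (hP : (G.ranked rank).IsPathLike Ep (LabelledGraph.identOfRank rank ident)) {S : Finset ℕ}
    (h0 : 0 ∈ S) (hS : ∀ x ∈ S, x = 0 ∨ x < σ * n)
    (hkey : ∀ a j, j < n → (G.ranked rank).IsKey Ep a j → a * n + j ∈ S) (hL : 0 < L)
    (hnL : n ≤ 2 ^ L) (hσL : σ * n ≤ 2 ^ L) (hw : 4 * L + 10 ≤ w) :
    ∃ I : Index, I.IsCorrect w ∧
      I.Represents (G.ranked rank) Ep (LabelledGraph.identOfRank rank ident) σ ∧
      I.n = n ∧ I.h = Nat.log 2 L ∧ I.m = S.card ∧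
      (∀ k < 22, ∀ i < I.len k, I.get k i < 2 ^ w) ∧
      (pack I.len I.get 22).length ≤ 90 * S.card ∧ (pack I.len I.get 22).length < 2 ^ w := by
  classical
  set X := G.ranked rank with hXdef
  set idr := LabelledGraph.identOfRank rank ident with hidr
  have hSL : ∀ x ∈ S, x < 2 ^ L := by
    intro x hx
    rcases hS x hx with rfl | h
    · exact Nat.two_pow_pos L
    · omega
  obtain ⟨K, hK, hsurj⟩ := exists_isKeys S h0 hL hSL
  set m := S.card with hmdef
  -- Bertrand's postulate gives a prime above all node numbers that still has only `2 * L + 1` bits.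
  obtain ⟨p, hp, hlp, hpl⟩ := Nat.exists_prime_lt_and_le_two_mul (2 ^ (2 * L))
    (Nat.two_pow_pos _).ne'
  have hnode : ∀ x ∈ nodes K m L, x < p := fun x hx => (lt_of_mem_nodes hK hx).trans hlp
  obtain ⟨H, hH⟩ := PerfectHash.exists_isPerfect hp (nodes K m L) hnode
  have hHp := hH.prime_eq
  let slot : ℕ → ℕ := fun t =>
    if h : ∃ x ∈ nodes K m L, H.pos x = t then h.choose else p
  have hslot : ∀ x ∈ nodes K m L, slot (H.pos x) = x := by
    intro x hx
    have h : ∃ y ∈ nodes K m L, H.pos y = H.pos x := ⟨x, hx, rfl⟩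
    simp only [slot, dif_pos h]
    exact hH.injOn h.choose_spec.1 hx h.choose_spec.2
  have hslot_or : ∀ t, slot t ∈ nodes K m L ∨ slot t = p := by
    intro t
    by_cases h : ∃ y ∈ nodes K m L, H.pos y = t
    · simp only [slot, dif_pos h]
      exact .inl h.choose_spec.1
    · simp only [slot, dif_neg h]
      exact .inr trivial
  have hmL : m ≤ 2 ^ L := by
    have : S ⊆ Finset.range (2 ^ L) := fun x hx => Finset.mem_range.2 (hSL x hx)
    simpa using Finset.card_le_card this
  let I : Index :=
    { n := n, id₀ := idr (n - 1), m := m, L := L, h := Nat.log 2 L, key := K, hash := H,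
      slot := slot
      mode := fun i => if X.Good Ep (K i / n) (K i % n) then 1 else 0
      lastSrc := fun i => X.lastSrc (K i / n) (K i % n)
      lastTgt := fun i => X.lastTgt (K i / n) (K i % n)
      lastId := fun i => idr (X.lastTgt (K i / n) (K i % n))
      first := fun i => X.firstTgt (K i / n) (K i % n)
      next := fun i => X.firstTgt (K i / n) (K i % n + 1) }
  have hI : I.IsCorrect w :=
    { keys := hK
      perfect := hHp.symm ▸ hH
      lt_prime := hHp.symm ▸ hlp
      prime_le := by
        change H.prime ≤ 2 ^ (2 * L + 1)
        rw [hHp, pow_succ]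
        omega
      slot_pos := hslot
      slot_or := fun t => hHp.symm ▸ hslot_or t
      lt_step := Nat.lt_pow_succ_log_self (by norm_num) L
      step_le := Nat.pow_log_le_self 2 hL.ne'
      m_le := hmL
      le_word := hw }
  have hR : I.Represents X Ep idr σ :=
    { isWheeler := hX
      isPathLike := hP
      id₀_eq := rfl
      exists_key := fun a j hj h => hsurj _ (hkey a j hj h)
      n_le := hnL
      mul_le := hσL
      mode_eq_zero := fun i _ => by
        change (if X.Good Ep (K i / n) (K i % n) then 1 else 0) = 0 ↔ _
        split_ifs with h
        · simpa [I] using h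
        · simpa [I] using h
      lastSrc_eq := fun _ _ => rfl
      lastTgt_eq := fun _ _ => rfl
      lastId_eq := fun _ _ => rfl
      first_eq := fun _ _ => rfl
      next_eq := fun _ _ => rfl }
  have hsize : H.size ≤ 2 * m + 1 := by
    have := hH.size_le
    have := card_nodes_le K m L
    omega
  have htotal : H.total ≤ 10 * m + 1 := by
    have := hH.total_le
    have := card_nodes_le K m L
    omega
  have hm0 := hK.pos
  -- The 30 consists of 22 table addresses and 8 tables with one entry. As `m` is positive, the
  -- total is at most `37 + 53 * m ≤ 90 * m`.
  have hlen : (pack I.len I.get 22).length = 30 + 3 * H.size + 4 * H.total + 7 * m := by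
    rw [length_pack]
    simp only [Finset.sum_range_succ, Finset.sum_range_zero, Index.len, I]
    norm_num
    ring
  have hword : 2 ^ L * 2 ^ 7 ≤ 2 ^ w ∧ 2 ^ (2 * L + 2) ≤ 2 ^ w := by
    rw [← pow_add]
    exact ⟨Nat.pow_le_pow_right (by norm_num) (by omega),
      Nat.pow_le_pow_right (by norm_num) (by omega)⟩
  have hLL : 2 ^ L ≤ 2 ^ (2 * L) := Nat.pow_le_pow_right (by norm_num) (by omega)
  have hL2 : L < 2 ^ L := Nat.lt_two_pow_self
  have hpow4 : 2 ^ (2 * L + 2) = 2 ^ (2 * L) * 4 := by rw [pow_add]; norm_num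
  have h1L := Nat.one_le_two_pow (n := L)
  have hlog : 2 ^ Nat.log 2 L ≤ L := Nat.pow_log_le_self 2 hL.ne'
  have hpw : p < 2 ^ w := by omega
  refine ⟨I, hI, hR, rfl, rfl, rfl, ?_, by omega, by omega⟩
  have hcount : ∀ y, sampleCount K m L y * L < 2 ^ w := fun y => by
    have := sampleCount_mul_le hK y
    omega
  have hKw : ∀ i, K i < 2 ^ w := fun i => by have := hK.lt i; omega
  have hidle : ∀ r, idr r ≤ n := LabelledGraph.identOfRank_le rank ident
  intro k hk i hi
  interval_cases k <;> simp only [Index.get, Index.len, I] at hi ⊢ <;> norm_num at hi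
  · omega
  · have := hidle (n - 1); omega
  · omega
  · omega
  · omega
  · omega
  · have := hH.mult_lt; omega
  · omega
  · have := hH.mult₂_lt i; omega
  · have := hH.size₂_le i hi; omega
  · have := hH.offset_le i hi; omega
  · rcases hslot_or i with h | h
    · have := hnode _ h; omega
    · omega
  · exact hKw _
  · exact hcount _
  · exact hcount _
  · exact hKw _
  · split_ifs <;> omega
  · have := hX.lastSrc_le (K i / n) (K i % n); omega
  · have := hX.lastTgt_le (K i / n) (K i % n); omega
  · have := hidle (X.lastTgt (K i / n) (K i % n)); omega
  · have := hX.firstTgt_le (K i / n) (K i % n); omega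
  · have := hX.firstTgt_le (K i / n) (K i % n + 1); omega

end

end WordRAM

/-! ### Final bounds -/

/-- The left side is the number of rounds of a bisection over keys of `(c + 1) * (log n + 1)` bits.
-/
theorem log_log_bound (c n : ℕ) :
    Nat.log 2 ((c + 1) * (Nat.log 2 n + 1)) + 1 ≤ (c + 4) * max 1 (Nat.log 2 (Nat.log 2 n)) := by
  set μ := Nat.log 2 (Nat.log 2 n) with hμ
  have h1 : Nat.log 2 n + 1 ≤ 2 ^ (μ + 1) := Nat.lt_pow_succ_log_self (by norm_num) _
  have h2 : c + 1 ≤ 2 ^ c := Nat.lt_two_pow_self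
  have h3 : (c + 1) * (Nat.log 2 n + 1) ≤ 2 ^ (c + (μ + 1)) := by
    rw [pow_add]
    exact Nat.mul_le_mul h2 h1
  have h4 : Nat.log 2 ((c + 1) * (Nat.log 2 n + 1)) ≤ c + (μ + 1) := by
    have := Nat.log_mono_right (b := 2) h3
    rwa [Nat.log_pow (by norm_num)] at this
  have h5 : 1 ≤ max 1 μ := le_max_left _ _
  have h6 : μ ≤ max 1 μ := le_max_right _ _
  nlinarith

theorem succ_pow_le_two_pow (c n : ℕ) : (n + 1) ^ c ≤ 2 ^ (c * (Nat.log 2 n + 1)) := by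
  rw [mul_comm, pow_mul]
  exact Nat.pow_le_pow_left (Nat.lt_pow_succ_log_self (by norm_num) n) c

theorem lemma1 :
    ∃ query : WordRAM.Cmd, ∀ c : ℕ, ∃ C K : ℕ,
      ∀ (V E : Type*) [Finite E] (n σ : ℕ) (G : LabelledGraph V E σ)
        (rank : V ≃ Fin n) (B : List (Fin σ)) (D : List (List E)) (ident : V ≃ Fin n),
        Nat.card E ≤ (n + 1) ^ c → σ ≤ (n + 1) ^ c →
        G.IsWheelerOrder rank → G.IsBWT rank B →
        G.IsPathDecomposition D → G.IsIdentifier D ident →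
        ∀ w : ℕ, K * (Nat.log 2 n + 1) ≤ w →
          ∃ data : List ℕ, (∀ x ∈ data, x < 2 ^ w) ∧
            data.length ≤ C * max 1 (runCount B + D.length) ∧
            ∀ P : List (Fin σ), ∃ (t : ℕ) (s : WordRAM.State),
              WordRAM.Exec w data query
                (WordRAM.State.start (P.map (fun a : Fin σ => a.val))) t s ∧
              t ≤ C * (max 1 P.length * max 1 (Nat.log 2 (Nat.log 2 n))) ∧
              IsToeholdAnswer G rank ident P s.reg := by
  -- Key codes are below `σ * n ≤ (n + 1) ^ (c + 1)` (or 0), which fits in `L = (c + 1) * (log n +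
  -- 1)` bits, and the second constant ensures `4 * L + 10 ≤ w`. The first covers both the space,
  -- `90 * 28`, and the time, `30 + 610 * (c + 4)`.
  refine ⟨WordRAM.toehold, fun c => ⟨640 * (c + 8), 4 * (c + 1) + 10, ?_⟩⟩
  intro V E _ n σ G rank B D ident _ hσ hW hB hD hi w hw
  have := Fintype.ofFinite E
  obtain ⟨S, h0, hS, hkey, hcard⟩ := LabelledGraph.exists_breakpoints hW hB hD hi
  have hl : 1 ≤ Nat.log 2 n + 1 := by omega
  have hL : 0 < (c + 1) * (Nat.log 2 n + 1) := by positivity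
  have hpow : (n + 1) ^ c * (n + 1) ≤ 2 ^ ((c + 1) * (Nat.log 2 n + 1)) := by
    rw [← pow_succ]
    exact succ_pow_le_two_pow (c + 1) n
  have h1 : 1 ≤ (n + 1) ^ c := Nat.one_le_pow _ _ (by omega)
  have hnL : n ≤ 2 ^ ((c + 1) * (Nat.log 2 n + 1)) := by nlinarith
  have hσL : σ * n ≤ 2 ^ ((c + 1) * (Nat.log 2 n + 1)) := by nlinarith
  have hword : 4 * ((c + 1) * (Nat.log 2 n + 1)) + 10 ≤ w := by nlinarith
  have hσw : σ < 2 ^ w := by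
    have h2 : σ ≤ 2 ^ ((c + 1) * (Nat.log 2 n + 1)) := by nlinarith
    exact h2.trans_lt (Nat.pow_lt_pow_right (by norm_num) (by omega))
  obtain ⟨I, hI, hR, hIn, hIh, -, hval, hlen, hlenw⟩ := WordRAM.exists_index
    hW.isWheeler_ranked (hD.isPathLike hi) h0 hS hkey hL hnL hσL hword
  refine ⟨WordRAM.pack I.len I.get 22, WordRAM.lt_of_mem_pack hval hlenw, ?_, fun P => ?_⟩
  · refine hlen.trans ((Nat.mul_le_mul_left 90 hcard).trans ?_)
    rw [← mul_assoc]
    exact Nat.mul_le_mul_right _ (by omega)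
  · obtain ⟨t, s, he, ht, hA⟩ := WordRAM.halts_toehold hI (WordRAM.hasTables_pack hlenw.le) hR
      hIn hσw P
    refine ⟨t, s, he, ht.trans ?_, hA⟩
    rw [hIh]
    have h2 := log_log_bound c n
    set M := max 1 (Nat.log 2 (Nat.log 2 n)) with hM
    have h3 : 1 ≤ max 1 P.length * M := Nat.mul_pos (by omega) (by omega)
    have h4 : P.length * (610 * (Nat.log 2 ((c + 1) * (Nat.log 2 n + 1)) + 1)) ≤
        max 1 P.length * (610 * ((c + 4) * M)) :=
      Nat.mul_le_mul (le_max_right _ _) (Nat.mul_le_mul_left _ h2)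
    have h5 : max 1 P.length * (610 * ((c + 4) * M)) =
        (610 * (c + 4)) * (max 1 P.length * M) := by ring
    have h6 : 30 + (610 * (c + 4)) * (max 1 P.length * M) ≤
        640 * (c + 8) * (max 1 P.length * M) := by
      calc _ ≤ 30 * (max 1 P.length * M) + (610 * (c + 4)) * (max 1 P.length * M) := by omega
        _ = (30 + 610 * (c + 4)) * (max 1 P.length * M) := by ring
        _ ≤ _ := Nat.mul_le_mul_right _ (by omega)
    omega
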